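/- **Bottom edge lemma.** Let $x$ be a feasible half-integral solution of the subtour (Held–Karp) LP on a finite vertex set $V$: $x_{\{u,v\}}\in\{0,\tfrac12,1\}$, $\sum_v x_{\{u,v\}}=2$ for every $u$, and $x(\delta(S))\ge 2$ for every $\emptyset\ne S\subsetneq V$. Let $e^+$ be a pair with $x_{e^+}=1$, and let $G$ be the support multigraph of $x$ (one edge for each pair of value $\tfrac12$, two parallel edges for each pair of value $1$). A vertex set $S$ of $G$ or of a contraction of $G$ is *tight* if $|\delta(S)|=4$, and *proper* if $S$ and its complement both have at least two vertices; two sets $S,S'$ *cross* if $S\setminus S'$, $S'\setminus S$, $S\cap S'$ and the complement of $S\cup S'$ are all non-empty. Consider any execution of the following procedure. While the current graph has a proper tight set crossed by no tight set, choose an inclusion-minimal such set $S$ with $e^+\notin E(S)$; sample a spanning tree of $(S,E(S))$ from the maximum entropy distribution with marginals $\tfrac12$ (a distribution in which the probability of a tree is proportional to the product of nonnegative weights of its edges, and every edge of $E(S)$ is in the tree with probability $\tfrac12$); contract $S$. When the loop ends, sample uniformly a cycle through all vertices of the remaining graph that contains (a copy of) $e^+$. All samples are independent, and $T$ is the union of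 the sampled edge sets. The sets $S$ chosen in the loop, viewed as sets of original vertices, and the single vertices as degenerate ones, are the *critical sets*; the root of their hierarchy is the graph that remains at the end. For an edge $e=\{u,v\}$ of $G$, let $S_{u,e}$ be the highest (largest) critical set that contains $u$ but not $v$, define $S_{v,e}$ symmetrically, and let $S_e$ be the critical set, or the root, that has both $S_{u,e}$ and $S_{v,e}$ as (contracted) vertices. A critical set $S$ gives a *cycle cut* if, at the time it is chosen, it has exactly two vertices or it strictly contains a proper tight set; the root counts as a cycle cut as well. An edge $e$ is a *bottom edge* if $S_e$ is a cycle cut. A bottom edge $e$ is *even at last* if every minimum cut containing $e$ in the graph obtained from the graph at the time $S_e$ is chosen by contracting the complement of $S_e$ (for the root: in the remaining graph itself) has an even number of edges in $T$; among these cuts are the two last cuts of $e$. Two edges of $\delta(S_e)$ are *cycle partners* if they have the same end vertex inside $S_e$ at the time $S_e$ is chosen. Then every bottom edge $e$ is good with constant $p = 3/16$, that is, $$\Pr[e\text{ is even at last}]\ \ge\ \tfrac{3}{16}.$$ Moreover, the probability that each pair of cycle partners on $\delta(S_e)$ has exactly one edge in $T$ is also at least $\tfrac{3}{16}$ (for the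 root there are no such pairs). -/

import Mathlib

/-- An edge of a multigraph on `V` with multiplicities at most two: a pair of end points and the
number of the copy. -/
abbrev Edge (V : Type*) := Sym2 V × Fin 2

namespace HalfIntegralTSP

variable {V : Type*} [Fintype V] [DecidableEq V]

/-- `x` is a feasible half-integral solution of the subtour elimination (Held-Karp) LP on the
vertex set `V`. -/
structure IsHalfIntegralSubtour (x : Sym2 V → ℝ) : Prop where
  loopless : ∀ v, x s(v, v) = 0
  half_integral : ∀ f, x f = 0 ∨ x f = 1 / 2 ∨ x f = 1
  degree : ∀ u, ∑ v, x s(u, v) = 2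
  subtour : ∀ S : Finset V, S.Nonempty → S ≠ Finset.univ → 2 ≤ ∑ u ∈ S, ∑ v ∈ Sᶜ, x s(u, v)

open Classical in
/-- The support graph of `x`, in which a pair of value `1 / 2` is one edge and a pair of value `1`
is two parallel edges. -/
noncomputable def supportGraph (x : Sym2 V → ℝ) : Finset (Edge V) :=
  Finset.univ.filter fun e => ((e.2 : ℕ) : ℝ) + 1 ≤ 2 * x e.1

/-- The edge `e` joins a vertex of `X` to a vertex of `Y`. -/
def Joins (e : Edge V) (X Y : Finset V) : Prop :=
  ∃ u ∈ X, ∃ v ∈ Y, e.1 = s(u, v)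

open Classical in
/-- The cut `δ(X)` in the graph `G`. -/
noncomputable def cut (G : Finset (Edge V)) (X : Finset V) : Finset (Edge V) :=
  G.filter fun e => Joins e X Xᶜ

/-! A contraction of `G` is represented by its set `N` of nodes, a partition of `V` whose parts are
the sets of original vertices that have been merged. A set of vertices of the contracted graph is a
subset `A` of `N`. -/

/-- The original vertices in a set of nodes. -/
def verts (A : Finset (Finset V)) : Finset V := A.biUnion id

open Classical in
/-- The edges `E(A)` of the contracted graph with both ends in the set `A` of nodes; an edge inside
a single node has disappeared. -/
noncomputable def innerEdges (G : Finset (Edge V)) (A : Finset (Finset V)) : Finset (Edge V) :=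
  G.filter fun e => ∃ X ∈ A, ∃ Y ∈ A, X ≠ Y ∧ Joins e X Y

/-- A set of nodes is tight if its boundary has `4` edges, the size of a minimum cut. -/
def IsTight (G : Finset (Edge V)) (A : Finset (Finset V)) : Prop :=
  (cut G (verts A)).card = 4

/-- `A` is a proper set of vertices of the graph with vertex set `N`. -/
def IsProper (N A : Finset (Finset V)) : Prop :=
  A ⊆ N ∧ 2 ≤ A.card ∧ 2 ≤ (N \ A).card

/-- `A` and `B` cross in the graph with vertex set `N`. -/
def Crosses (N A B : Finset (Finset V)) : Prop :=
  (A \ B).Nonempty ∧ (B \ A).Nonempty ∧ (A ∩ B).Nonempty ∧ (N \ (A ∪ B)).Nonempty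

/-- `A` is a proper tight set of the contracted graph which no tight set crosses. -/
def IsUncrossed (G : Finset (Edge V)) (N A : Finset (Finset V)) : Prop :=
  IsProper N A ∧ IsTight G A ∧ ∀ B ⊆ N, IsTight G B → ¬ Crosses N A B

/-- `A` is an uncrossed proper tight set with `f ∉ E(A)`. -/
def IsCandidate (G : Finset (Edge V)) (f : Sym2 V) (N A : Finset (Finset V)) : Prop :=
  IsUncrossed G N A ∧ ¬ ∀ v ∈ f, v ∈ verts A

/-- The edges in `T` connect the nodes in `A`. -/
def Connects (T : Finset (Edge V)) (A : Finset (Finset V)) : Prop :=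
  ∀ X ∈ A, ∀ Y ∈ A,
    Relation.ReflTransGen (fun X' Y' => X' ∈ A ∧ Y' ∈ A ∧ ∃ e ∈ T, Joins e X' Y') X Y

/-- `T` is a spanning tree of the contracted graph `(A, E(A))`. -/
def IsSpanningTree (G : Finset (Edge V)) (A : Finset (Finset V)) (T : Finset (Edge V)) : Prop :=
  T ⊆ innerEdges G A ∧ Connects T A ∧ T.card + 1 = A.card

open Classical in
/-- `p` is the maximum entropy distribution on the spanning trees of `(A, E(A))` with the
marginals `1 / 2` that the LP solution gives to every edge of the support graph: the probability of
a tree is proportional to the product of nonnegative weights of its edges. -/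
def IsMaxEntropy (G : Finset (Edge V)) (A : Finset (Finset V))
    (p : Finset (Edge V) → ℝ) : Prop :=
  (∃ w : Edge V → ℝ, (∀ e, 0 ≤ w e) ∧
    0 < ∑ T ∈ Finset.univ.filter (IsSpanningTree G A), ∏ e ∈ T, w e ∧
    ∀ T, p T = if IsSpanningTree G A T then
      (∏ e ∈ T, w e) / ∑ T' ∈ Finset.univ.filter (IsSpanningTree G A), ∏ e ∈ T', w e
      else 0) ∧
  ∀ e ∈ innerEdges G A, ∑ T ∈ Finset.univ.filter (fun T => e ∈ T), p T = 1 / 2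

/-- `T` is a cycle through all nodes in `N` of the contracted graph, and it contains a copy of
`f`. -/
def IsTour (G : Finset (Edge V)) (f : Sym2 V) (N : Finset (Finset V))
    (T : Finset (Edge V)) : Prop :=
  T ⊆ innerEdges G N ∧ Connects T N ∧ (∀ X ∈ N, (T ∩ cut G X).card = 2) ∧ ∃ e ∈ T, e.1 = f

open Classical in
/-- The uniform distribution on these cycles. -/
noncomputable def tourLaw (G : Finset (Edge V)) (f : Sym2 V) (N : Finset (Finset V))
    (T : Finset (Edge V)) : ℝ :=
  if IsTour G f N T then 1 / ((Finset.univ.filter (IsTour G f N)).card : ℝ) else 0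

/-- An execution of the sampling algorithm on the graph `G` with distinguished pair `f` (the pair
`e⁺` of value `1`). The while loop is run `k` times. Before round `i` the graph has been contracted
to the node set `nodes i`; round `i < k` selects the set `sel i`, samples a spanning tree on it
from `law i`, and contracts it. When the loop ends, a cycle through the remaining graph is sampled
uniformly; this is step `k`, with `sel k` the set of all remaining nodes. -/
structure Execution (G : Finset (Edge V)) (f : Sym2 V) where
  k : ℕ
  nodes : ℕ → Finset (Finset V)
  sel : ℕ → Finset (Finset V)
  law : ℕ → Finset (Edge V) → ℝ
  nodes_zero : nodes 0 = Finset.univ.image fun v => {v}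
  sel_candidate : ∀ i < k, IsCandidate G f (nodes i) (sel i)
  sel_minimal : ∀ i < k, ∀ B ⊂ sel i, ¬ IsCandidate G f (nodes i) B
  nodes_succ : ∀ i < k, nodes (i + 1) = insert (verts (sel i)) (nodes i \ sel i)
  law_maxEntropy : ∀ i < k, IsMaxEntropy G (sel i) (law i)
  loop_end : ∀ A, ¬ IsUncrossed G (nodes k) A
  sel_last : sel k = nodes k
  law_last : law k = tourLaw G f (nodes k)

namespace Execution

variable {G : Finset (Edge V)} {f : Sym2 V} (R : Execution G f)

open Classical in
/-- The probability that the random edge set `T` has the property `Q`, where `T` is the union of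
independent samples from the distributions `law 0, …, law k`. -/
noncomputable def prob (Q : Finset (Edge V) → Prop) : ℝ :=
  ∑ ω : Fin (R.k + 1) → Finset (Edge V),
    if Q (Finset.univ.biUnion ω) then ∏ i : Fin (R.k + 1), R.law i (ω i) else 0

/-- The critical sets are the selected sets, and the vertices as degenerate critical sets. -/
def IsCritical (X : Finset V) : Prop :=
  (∃ v, X = {v}) ∨ ∃ i < R.k, X = verts (R.sel i)

/-- `X` is the highest critical set that contains `u` but not `v`. -/
def IsHighest (u v : V) (X : Finset V) : Prop :=
  R.IsCritical X ∧ u ∈ X ∧ v ∉ X ∧ ∀ Y, R.IsCritical Y → u ∈ Y → v ∉ Y → Y ⊆ X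

/-- `S_e` is the set selected in round `i` (for `i = k`, the root of the hierarchy): the highest
critical sets that contain exactly one end of `e` are nodes of it. A node belongs to the selected
set of one round only, so that there is at most one such `i`. -/
def IsParentIndex (e : Edge V) (i : ℕ) : Prop :=
  i ≤ R.k ∧ ∃ u v X Y, e.1 = s(u, v) ∧ R.IsHighest u v X ∧ R.IsHighest v u Y ∧
    X ∈ R.sel i ∧ Y ∈ R.sel i

/-- The set selected in round `i` is a cycle cut: there is a proper minimum cut inside it, or it
has two nodes only, so that contracting its complement gives a triangle with doubled edges. The
last step `i = k` samples from a cycle, and counts as well. -/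
def IsCycle (i : ℕ) : Prop :=
  i = R.k ∨ (R.sel i).card = 2 ∨ ∃ B ⊂ R.sel i, 2 ≤ B.card ∧ IsTight G B

/-- `e` is a bottom edge: `S_e` is a cycle cut. -/
def IsBottom (e : Edge V) : Prop :=
  ∃ i, R.IsParentIndex e i ∧ R.IsCycle i

/-- `e` is even at last. For a bottom edge: all minimum cuts containing `e` of the cycle which
results from `S_e` by contracting its complement (among them the two last cuts of `e`) have an even
number of edges in `T`. For a top edge: so have the two cuts defined by the nodes of `S_e` that
contain one end of `e`. -/
def EvenAtLast (e : Edge V) (T : Finset (Edge V)) : Prop :=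
  ∃ i, R.IsParentIndex e i ∧
    (R.IsCycle i → ∀ B ⊆ R.sel i, IsTight G B → e ∈ cut G (verts B) →
      Even (T ∩ cut G (verts B)).card) ∧
    (¬ R.IsCycle i → ∀ X ∈ R.sel i, e ∈ cut G X → Even (T ∩ cut G X).card)

/-- `e` is good with constant `p`. -/
def IsGood (e : Edge V) (p : ℝ) : Prop :=
  0 < p ∧ p ≤ R.prob (R.EvenAtLast e)

/-- `a` and `b` are cycle partners with respect to the boundary of the set selected in round `i`:
two edges of this boundary with the same end node inside the set. -/
def IsCyclePartners (i : ℕ) (a b : Edge V) : Prop :=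
  a ≠ b ∧ a ∈ cut G (verts (R.sel i)) ∧ b ∈ cut G (verts (R.sel i)) ∧
    ∃ X ∈ R.sel i, a ∈ cut G X ∧ b ∈ cut G X

/-- From each pair of cycle partners on the boundary of `S_e`, exactly one edge is in `T`. -/
def PartnersSplit (e : Edge V) (T : Finset (Edge V)) : Prop :=
  ∃ i, R.IsParentIndex e i ∧ ∀ a b, R.IsCyclePartners i a b → Xor (a ∈ T) (b ∈ T)

end Execution

end HalfIntegralTSP

/-!
A four-regular, 4-edge-connected multigraph in which every proper tight set is crossed by a tight
set is a cycle of doubled edges as soon as it has a proper tight set or just three vertices: the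
corners of a crossing pair are again tight, which forces the edges into parallel pairs. This applies
to every cycle cut with its complement contracted, and to the remaining graph, where the two copies
of `e⁺` supply a tight set.

Call a probability on edge sets determinantal when every inclusion probability is a principal
minor of one fixed symmetric idempotent kernel. A maximum entropy tree is determinantal by the
matrix-tree theorem, and so is a uniform tour of a doubled cycle, which picks one edge of each
parallel pair independently. Independent unions correspond to block-diagonal kernels, so `T` is
determinantal, and the kernel has diagonal `1 / 2`.

A spanning tree has at most one edge of each parallel pair and one in expectation, hence exactly
one, so inside the cycle cut of `e` every pair is split with certainty. Once the two pairs joining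
it to its contracted complement are split too, every minimum cut has exactly two edges in `T`.
For a symmetric idempotent kernel with diagonal `1 / 2`, two disjoint pairs of edges are both
split with probability at least `1 / 4`.
-/

namespace HalfIntegralTSP

theorem card_filter_image_univ_eq {n E : Type*} [Fintype n] [DecidableEq n] [Fintype E]
    [DecidableEq E] {T : Finset E} (hT : T.card = Fintype.card n) :
    (Finset.univ.filter fun φ : n → E => Finset.univ.image φ = T).card =
      (Fintype.card n).factorial := by
  rw [← Fintype.card_equiv (Fintype.equivOfCardEq (by simp [hT]) : n ≃ T), ← Finset.card_univ]
  refine (Finset.card_bij (fun ψ _ i => (ψ i : E)) (fun ψ _ => ?_) (fun ψ _ ψ' _ h => ?_)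
    fun φ hφ => ?_).symm
  · rw [Finset.mem_filter_univ]
    ext e
    simp only [Finset.mem_image, Finset.mem_univ, true_and]
    exact ⟨fun ⟨i, hi⟩ => hi ▸ (ψ i).2, fun he => ⟨ψ.symm ⟨e, he⟩, by simp⟩⟩
  · ext i
    exact congrFun h i
  · rw [Finset.mem_filter_univ] at hφ
    have mem_T (i : n) : φ i ∈ T := hφ ▸ Finset.mem_image_of_mem _ (Finset.mem_univ i)
    have surjective : Function.Surjective fun i => (⟨φ i, mem_T i⟩ : T) := by
      rintro ⟨e, he⟩
      obtain ⟨i, -, hi⟩ := Finset.mem_image.1 (hφ ▸ he)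
      exact ⟨i, Subtype.ext hi⟩
    exact ⟨Equiv.ofBijective _
      ((Fintype.bijective_iff_surjective_and_card _).2 ⟨surjective, by simp [hT]⟩),
      Finset.mem_univ _, rfl⟩

section Determinants

open Matrix

variable {n E R : Type*} [Fintype n] [DecidableEq n] [Fintype E] [CommRing R]

theorem det_mul_eq_sum_prod_mul_det (A : Matrix n E R) (C : Matrix E n R) :
    (A * C).det = ∑ φ : n → E, (∏ i, A i (φ i)) * (C.submatrix φ id).det := by
  classical
  have row_eq : A * C = Matrix.of fun i => ∑ e, A i e • C e := by
    ext i j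
    simp only [mul_apply, of_apply, Finset.sum_apply, Pi.smul_apply, smul_eq_mul]
  rw [row_eq]
  exact ((detRowAlternating (n := n) (R := R)).toMultilinearMap.map_sum _).trans
    (Finset.sum_congr rfl fun φ _ =>
      (detRowAlternating (n := n) (R := R)).toMultilinearMap.map_smul_univ (fun i => A i (φ i)) _)

theorem factorial_mul_det_mul (A : Matrix n E R) (C : Matrix E n R) :
    ((Fintype.card n).factorial : R) * (A * C).det =
      ∑ φ : n → E, (A.submatrix id φ).det * (C.submatrix φ id).det := by
  classical
  have det_eq (σ : Equiv.Perm n) : (A * C).det = ∑ φ : n → E,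
      (σ.sign : R) * (∏ i, A i (φ (σ i))) * (C.submatrix φ id).det := by
    rw [det_mul_eq_sum_prod_mul_det, ← (σ.symm.arrowCongr (Equiv.refl E)).sum_comp]
    refine Finset.sum_congr rfl fun φ _ => ?_
    have det_comp : (C.submatrix (φ ∘ σ) id).det = (σ.sign : R) * (C.submatrix φ id).det :=
      det_permute σ (C.submatrix φ id)
    change (∏ i, A i (φ (σ i))) * (C.submatrix (φ ∘ σ) id).det = _
    rw [det_comp]
    ring
  calc ((Fintype.card n).factorial : R) * (A * C).det
      = ∑ _σ : Equiv.Perm n, (A * C).det := by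
        rw [Finset.sum_const, Finset.card_univ, Fintype.card_perm, nsmul_eq_mul]
    _ = ∑ φ : n → E, ∑ σ : Equiv.Perm n,
          (σ.sign : R) * (∏ i, A i (φ (σ i))) * (C.submatrix φ id).det := by
        rw [Finset.sum_congr rfl fun σ _ => det_eq σ, Finset.sum_comm]
    _ = _ := by
        refine Finset.sum_congr rfl fun φ _ => ?_
        rw [← Finset.sum_mul, ← det_transpose (A.submatrix id φ), det_apply' (A.submatrix id φ)ᵀ]
        rfl

theorem factorial_mul_det_mul_diagonal_mul_transpose [DecidableEq E] (B : Matrix n E R)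
    (s : E → R) :
    ((Fintype.card n).factorial : R) * (B * diagonal s * Bᵀ).det =
      ∑ φ : n → E, (∏ i, s (φ i)) * (B.submatrix id φ).det ^ 2 := by
  rw [factorial_mul_det_mul]
  refine Finset.sum_congr rfl fun φ _ => ?_
  have submatrix_eq : (B * diagonal s).submatrix id φ =
      B.submatrix id φ * diagonal fun i => s (φ i) := by
    ext i j
    simp only [submatrix_apply, mul_diagonal, id]
  rw [submatrix_eq, det_mul, det_diagonal, ← transpose_submatrix, det_transpose]
  ring

theorem det_mul_diagonal_mul_transpose_eq_sum_prod [DecidableEq E] [IsDomain R] [CharZero R]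
    (B : Matrix n E R) (F : Finset (Finset E)) (hcard : ∀ T ∈ F, T.card = Fintype.card n)
    (hdet : ∀ φ : n → E, Function.Injective φ →
      (B.submatrix id φ).det ^ 2 = if Finset.univ.image φ ∈ F then 1 else 0) (s : E → R) :
    (B * diagonal s * Bᵀ).det = ∑ T ∈ F, ∏ e ∈ T, s e := by
  have term_eq (φ : n → E) : (∏ i, s (φ i)) * (B.submatrix id φ).det ^ 2 =
      if Finset.univ.image φ ∈ F then ∏ e ∈ Finset.univ.image φ, s e else 0 := by
    by_cases hφ : Function.Injective φ
    · rw [hdet φ hφ, mul_ite, mul_one, mul_zero, Finset.prod_image hφ.injOn]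
    · have notMem : Finset.univ.image φ ∉ F := fun h =>
        hφ <| Set.injOn_univ.1 <| by
        simpa using Finset.card_image_iff.1 (hcard _ h)
      obtain ⟨i, j, hij, hne⟩ := Function.not_injective_iff.1 hφ
      rw [det_zero_of_column_eq hne fun k => by simp [hij], if_neg notMem]
      simp
  apply mul_left_cancel₀ (Nat.cast_ne_zero.2 (Fintype.card n).factorial_ne_zero : _ ≠ (0 : R))
  rw [factorial_mul_det_mul_diagonal_mul_transpose, Finset.sum_congr rfl fun φ _ => term_eq φ,
    ← Finset.sum_fiberwise_of_maps_to (t := Finset.univ)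
      (g := fun φ => Finset.univ.image φ) fun _ _ => Finset.mem_univ _,
    Finset.mul_sum, ← Finset.sum_subset (Finset.subset_univ F)]
  · refine Finset.sum_congr rfl fun T hT => ?_
    rw [Finset.sum_congr rfl fun φ hφ => by rw [(Finset.mem_filter.1 hφ).2, if_pos hT],
      Finset.sum_const, card_filter_image_univ_eq (hcard T hT), nsmul_eq_mul]
  · intro T _ hT
    exact Finset.sum_eq_zero fun φ hφ => if_neg (by rwa [(Finset.mem_filter.1 hφ).2])

end Determinants

section DeterminantalLaws

open Matrix

variable {α : Type*} [Fintype α] [DecidableEq α]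

/-- The law `p` of a random subset of `E` is determinantal with the projection kernel `K`, which is
expressed through the generating function of `p`. -/
structure IsDeterminantal (p : Finset α → ℝ) (E : Finset α) (K : Matrix α α ℝ) : Prop where
  nonneg : ∀ T, 0 ≤ p T
  support : ∀ T, p T ≠ 0 → T ⊆ E
  isStarProjection : IsStarProjection K
  sum_mul_prod : ∀ s : α → ℝ,
    ∑ T, p T * ∏ e ∈ T, s e = (1 + K * diagonal fun e => s e - 1).det

namespace IsDeterminantal

variable {p : Finset α → ℝ} {E : Finset α} {K : Matrix α α ℝ}

theorem apply_comm (h : IsDeterminantal p E K) (a b : α) : K a b = K b a := by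
  simpa using congrFun₂ h.isStarProjection.isSelfAdjoint.star_eq b a

theorem sum_sq_eq (h : IsDeterminantal p E K) (a : α) : ∑ b, K a b ^ 2 = K a a := by
  conv_rhs => rw [← h.isStarProjection.isIdempotentElem.eq, mul_apply]
  exact Finset.sum_congr rfl fun b _ => by rw [sq, h.apply_comm b a]

theorem sum_eq_one (h : IsDeterminantal p E K) : ∑ T, p T = 1 := by
  simpa using h.sum_mul_prod 1

theorem sum_mul_prod_ite {ι : Type*} [Fintype ι] [DecidableEq ι] (h : IsDeterminantal p E K)
    {a : ι → α} (ha : Function.Injective a) (t : ι → ℝ) :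
    ∑ T, p T * ∏ i, (if a i ∈ T then t i else 1) =
      (1 + K.submatrix a a * diagonal fun i => t i - 1).det := by
  set s : α → ℝ := Function.extend a t 1 with hs
  have prod_eq (T : Finset α) : ∏ e ∈ T, s e = ∏ i, (if a i ∈ T then t i else 1) := by
    rw [← Finset.prod_ite_mem_eq]
    refine (Fintype.prod_of_injective a ha _ _ (fun e he => ?_) fun i => ?_).symm
    · rw [hs, Function.extend_apply' _ _ _ he, Pi.one_apply, ite_self]
    · rw [hs, ha.extend_apply]
  have diagonal_eq : (diagonal fun e => s e - 1) = (1 : Matrix α α ℝ).submatrix id a *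
      ((diagonal fun i => t i - 1) * (1 : Matrix α α ℝ).submatrix a id) := by
    ext b c
    rw [mul_apply]
    simp only [diagonal_apply, diagonal_mul, submatrix_apply, one_apply, id_eq, ite_mul, one_mul,
      zero_mul, mul_ite, mul_one, mul_zero]
    by_cases hb : ∃ i, a i = b
    · obtain ⟨i, rfl⟩ := hb
      rw [Fintype.sum_eq_single i fun j hj => by rw [if_neg (ha.ne hj.symm), ite_self], hs,
        ha.extend_apply, if_pos rfl]
    · have ne_apply (i : ι) : b ≠ a i := fun hi => hb ⟨i, hi.symm⟩
      simp only [ne_apply, if_false, ite_self, Finset.sum_const_zero]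
      rw [hs, Function.extend_apply' _ _ _ hb, Pi.one_apply, sub_self, ite_self]
  have submatrix_eq : (1 : Matrix α α ℝ).submatrix a id *
      (K * (1 : Matrix α α ℝ).submatrix id a) = K.submatrix a a := by
    ext i j
    simp [mul_apply, one_apply]
  simp only [← prod_eq]
  rw [h.sum_mul_prod, diagonal_eq, ← Matrix.mul_assoc, det_one_add_mul_comm, Matrix.mul_assoc,
    submatrix_eq, det_one_add_mul_comm]

theorem sum_filter_notMem (h : IsDeterminantal p E K) (e : α) :
    ∑ T with e ∉ T, p T = 1 - K e e := by
  have := h.sum_mul_prod_ite (Function.injective_of_subsingleton fun _ : Unit => e) 0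
  simpa [Finset.sum_filter, ← sub_eq_add_neg] using this

theorem sum_filter_mem (h : IsDeterminantal p E K) (e : α) :
    ∑ T with e ∈ T, p T = K e e := by
  linarith [Finset.sum_filter_add_sum_filter_not Finset.univ (fun T => e ∈ T) p, h.sum_eq_one,
    h.sum_filter_notMem e]

theorem apply_eq_zero (h : IsDeterminantal p E K) {a : α} (ha : a ∉ E) (b : α) : K a b = 0 := by
  have diag_eq_zero : K a a = 0 := by
    rw [← h.sum_filter_mem, Finset.sum_eq_zero]
    intro T hT
    by_contra hp
    exact ha (h.support T hp (Finset.mem_filter.1 hT).2)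
  have sum_eq_zero := (h.sum_sq_eq a).trans diag_eq_zero
  exact pow_eq_zero_iff two_ne_zero |>.1 <|
    (Finset.sum_eq_zero_iff_of_nonneg fun b _ => sq_nonneg (K a b)).1 sum_eq_zero b
      (Finset.mem_univ b)

theorem mul_diagonal_mul_eq_zero (h : IsDeterminantal p E K) {p' : Finset α → ℝ} {E' : Finset α}
    {K' : Matrix α α ℝ} (h' : IsDeterminantal p' E' K') (hE : Disjoint E E') (s : α → ℝ) :
    K * diagonal s * K' = 0 := by
  ext a b
  rw [mul_apply, Matrix.zero_apply]
  refine Finset.sum_eq_zero fun c _ => ?_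
  rw [mul_diagonal]
  by_cases hc : c ∈ E
  · rw [h'.apply_eq_zero (Finset.disjoint_left.1 hE hc), mul_zero]
  · rw [h.apply_comm, h.apply_eq_zero hc, zero_mul, zero_mul]

theorem sum_mul_card_inter (h : IsDeterminantal p E K) (D : Finset α) :
    ∑ T, p T * (T ∩ D).card = ∑ e ∈ D, K e e := by
  have card_eq (T : Finset α) : ((T ∩ D).card : ℝ) = ∑ e ∈ D, if e ∈ T then 1 else 0 := by
    rw [Finset.sum_boole, Finset.filter_mem_eq_inter, Finset.inter_comm]
  simp only [card_eq, Finset.mul_sum, mul_ite, mul_one, mul_zero]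
  rw [Finset.sum_comm]
  exact Finset.sum_congr rfl fun e _ => by rw [← Finset.sum_filter, h.sum_filter_mem]

theorem card_inter_eq_of_le (h : IsDeterminantal p E K) {D : Finset α} {m : ℕ}
    (hD : ∑ e ∈ D, K e e = m) (hle : ∀ T, p T ≠ 0 → (T ∩ D).card ≤ m) {T : Finset α}
    (hT : p T ≠ 0) : (T ∩ D).card = m := by
  have defect_nonneg (T : Finset α) : 0 ≤ p T * (m - (T ∩ D).card) := by
    by_cases hp : p T = 0
    · rw [hp, zero_mul]
    · exact mul_nonneg (h.nonneg T) (sub_nonneg.2 (Nat.cast_le.2 (hle T hp)))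
  have sum_defect : ∑ T, p T * (m - (T ∩ D).card) = 0 := by
    simp only [mul_sub, Finset.sum_sub_distrib]
    rw [← Finset.sum_mul, h.sum_eq_one, h.sum_mul_card_inter, hD, one_mul, sub_self]
  have defect_eq_zero := (Finset.sum_eq_zero_iff_of_nonneg fun T _ => defect_nonneg T).1 sum_defect
    T (Finset.mem_univ T)
  exact_mod_cast (sub_eq_zero.1 ((mul_eq_zero.1 defect_eq_zero).resolve_left hT)).symm

end IsDeterminantal

theorem det_one_add_mul_diagonal_finset_sum {ι R : Type*} [CommRing R]
    {K : ι → Matrix α α R} {s : α → R} {I : Finset ι}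
    (hK : ∀ i ∈ I, ∀ j ∈ I, i ≠ j → K i * diagonal s * K j = 0) :
    (1 + (∑ i ∈ I, K i) * diagonal s).det = ∏ i ∈ I, (1 + K i * diagonal s).det := by
  classical
  induction I using Finset.induction_on with
  | empty => simp
  | insert i I hi ih =>
    rw [Finset.prod_insert hi, Finset.sum_insert hi, ← ih fun j hj l hl =>
      hK j (Finset.mem_insert_of_mem hj) l (Finset.mem_insert_of_mem hl), ← det_mul]
    have mul_sum_eq_zero : K i * diagonal s * ∑ j ∈ I, K j = 0 := by
      rw [Finset.mul_sum]
      exact Finset.sum_eq_zero fun j hj => hK i (Finset.mem_insert_self i I) j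
        (Finset.mem_insert_of_mem hj) fun hij => hi (hij ▸ hj)
    congr 1
    rw [add_mul (K i), mul_add, mul_one, add_mul 1 (K i * _), one_mul, ← Matrix.mul_assoc,
      mul_sum_eq_zero, Matrix.zero_mul, add_zero, add_assoc]

/-- The law of the union of independent random sets with the laws `p i`. -/
def unionLaw {ι : Type*} [Fintype ι] [DecidableEq ι] (p : ι → Finset α → ℝ) (T : Finset α) : ℝ :=
  ∑ ω : ι → Finset α with Finset.univ.biUnion ω = T, ∏ i, p i (ω i)

section Union

variable {ι : Type*} [Fintype ι] [DecidableEq ι] {p : ι → Finset α → ℝ} {E : ι → Finset α}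

theorem sum_unionLaw_mul (p : ι → Finset α → ℝ) (g : Finset α → ℝ) :
    ∑ T, unionLaw p T * g T =
      ∑ ω : ι → Finset α, (∏ i, p i (ω i)) * g (Finset.univ.biUnion ω) := by
  rw [← Finset.sum_fiberwise Finset.univ fun ω : ι → Finset α => Finset.univ.biUnion ω]
  refine Finset.sum_congr rfl fun T _ => ?_
  rw [unionLaw, Finset.sum_mul]
  exact Finset.sum_congr rfl fun ω hω => by rw [(Finset.mem_filter.1 hω).2]

theorem exists_of_unionLaw_ne_zero {T : Finset α} (hT : unionLaw p T ≠ 0) :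
    ∃ ω : ι → Finset α, Finset.univ.biUnion ω = T ∧ ∀ i, p i (ω i) ≠ 0 := by
  obtain ⟨ω, hω, hne⟩ := Finset.exists_ne_zero_of_sum_ne_zero hT
  exact ⟨ω, (Finset.mem_filter.1 hω).2,
    fun i => Finset.prod_ne_zero_iff.1 hne i (Finset.mem_univ i)⟩

theorem isDeterminantal_unionLaw {K : ι → Matrix α α ℝ}
    (h : ∀ i, IsDeterminantal (p i) (E i) (K i)) (hE : Pairwise fun i j => Disjoint (E i) (E j)) :
    IsDeterminantal (unionLaw p) (Finset.univ.biUnion E) (∑ i, K i) where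
  nonneg T := Finset.sum_nonneg fun ω _ => Finset.prod_nonneg fun i _ => (h i).nonneg _
  support T hT := by
    obtain ⟨ω, rfl, hω⟩ := exists_of_unionLaw_ne_zero hT
    exact Finset.biUnion_mono fun i _ => (h i).support _ (hω i)
  isStarProjection := by
    have mul_sum_eq (i : ι) : K i * ∑ j, K j = K i := by
      rw [Finset.mul_sum, Fintype.sum_eq_single i, (h i).isStarProjection.isIdempotentElem.eq]
      intro j hj
      simpa using (h i).mul_diagonal_mul_eq_zero (h j) (hE hj.symm) 1
    refine ⟨?_, isSelfAdjoint_sum _ fun i _ => (h i).isStarProjection.isSelfAdjoint⟩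
    rw [IsIdempotentElem, Finset.sum_mul]
    exact Finset.sum_congr rfl fun i _ => mul_sum_eq i
  sum_mul_prod s := by
    have prod_eq (ω : ι → Finset α) :
        (∏ i, p i (ω i)) * ∏ e ∈ Finset.univ.biUnion ω, s e =
          ∏ i, p i (ω i) * ∏ e ∈ ω i, s e := by
      by_cases hω : ∀ i, p i (ω i) ≠ 0
      · rw [Finset.prod_biUnion, Finset.prod_mul_distrib]
        exact fun i _ j _ hij =>
          (hE hij).mono ((h i).support _ (hω i)) ((h j).support _ (hω j))
      · push Not at hω
        obtain ⟨i, hi⟩ := hω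
        rw [Finset.prod_eq_zero (Finset.mem_univ i) hi, zero_mul,
          Finset.prod_eq_zero (Finset.mem_univ i) (by rw [hi, zero_mul])]
    rw [sum_unionLaw_mul, det_one_add_mul_diagonal_finset_sum fun i _ j _ hij =>
        (h i).mul_diagonal_mul_eq_zero (h j) (hE hij) _, Finset.sum_congr rfl fun ω _ => prod_eq ω,
      ← Finset.prod_congr rfl fun i _ => (h i).sum_mul_prod s, Finset.prod_univ_sum,
      Fintype.piFinset_univ]

theorem exists_isDeterminantal_unionLaw {c : ℝ}
    (h : ∀ i, ∃ K, IsDeterminantal (p i) (E i) K ∧ ∀ e ∈ E i, K e e = c)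
    (hE : Pairwise fun i j => Disjoint (E i) (E j)) :
    ∃ K, IsDeterminantal (unionLaw p) (Finset.univ.biUnion E) K ∧
      ∀ i, ∀ e ∈ E i, K e e = c := by
  choose K hK hdiag using h
  refine ⟨∑ i, K i, isDeterminantal_unionLaw hK hE, fun i e he => ?_⟩
  rw [Matrix.sum_apply, Fintype.sum_eq_single i, hdiag i e he]
  exact fun j hj => (hK j).apply_eq_zero (fun hej => Finset.disjoint_left.1 (hE hj) hej he) e

theorem apply_inter_ne_zero_of_unionLaw_ne_zero (h : ∀ i T, p i T ≠ 0 → T ⊆ E i)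
    (hE : Pairwise fun i j => Disjoint (E i) (E j)) {T : Finset α} (hT : unionLaw p T ≠ 0)
    (i : ι) : p i (T ∩ E i) ≠ 0 := by
  obtain ⟨ω, rfl, hω⟩ := exists_of_unionLaw_ne_zero hT
  suffices Finset.univ.biUnion ω ∩ E i = ω i by rw [this]; exact hω i
  refine Finset.Subset.antisymm (fun e he => ?_) fun e he =>
    Finset.mem_inter.2 ⟨Finset.mem_biUnion.2 ⟨i, Finset.mem_univ i, he⟩, h i _ (hω i) he⟩
  obtain ⟨he, hei⟩ := Finset.mem_inter.1 he
  obtain ⟨j, -, hej⟩ := Finset.mem_biUnion.1 he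
  obtain rfl : j = i := by
    by_contra hji
    exact Finset.disjoint_left.1 (hE hji) (h j _ (hω j) hej) hei
  exact hej

end Union

open Classical in
/-- The law of a random member of `F`, with probabilities proportional to the products of the
weights `w`. -/
noncomputable def productLaw (F : Finset (Finset α)) (w : α → ℝ) (T : Finset α) : ℝ :=
  if T ∈ F then (∏ e ∈ T, w e) / ∑ T' ∈ F, ∏ e ∈ T', w e else 0

theorem sum_productLaw_mul (F : Finset (Finset α)) (w : α → ℝ) (g : Finset α → ℝ) :
    ∑ T, productLaw F w T * g T =
      (∑ T ∈ F, (∏ e ∈ T, w e) * g T) / ∑ T ∈ F, ∏ e ∈ T, w e := by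
  rw [Finset.sum_div, ← Finset.sum_subset (Finset.subset_univ F) fun T _ hT => by
    rw [productLaw, if_neg hT, zero_mul]]
  exact Finset.sum_congr rfl fun T hT => by rw [productLaw, if_pos hT, div_mul_eq_mul_div]

/-- With `C = B √w`, the generating function is `det (C s Cᵀ) / det (C Cᵀ)`, and the kernel is the
orthogonal projection `Cᵀ (C Cᵀ)⁻¹ C` onto the row space of `C`. -/
theorem exists_isDeterminantal_productLaw {n : Type*} [Fintype n] [DecidableEq n]
    {B : Matrix n α ℝ} {F : Finset (Finset α)} {E : Finset α} {w : α → ℝ}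
    (hB : ∀ s : α → ℝ, (B * diagonal s * Bᵀ).det = ∑ T ∈ F, ∏ e ∈ T, s e)
    (hF : ∀ T ∈ F, T ⊆ E) (hw : ∀ e, 0 ≤ w e) (hZ : ∑ T ∈ F, ∏ e ∈ T, w e ≠ 0) :
    ∃ K, IsDeterminantal (productLaw F w) E K := by
  set C : Matrix n α ℝ := B * diagonal fun e => √(w e) with hC
  have mul_diagonal_mul (s : α → ℝ) :
      C * diagonal s * Cᵀ = B * diagonal (fun e => s e * w e) * Bᵀ := by
    rw [hC, transpose_mul, diagonal_transpose]
    simp only [Matrix.mul_assoc]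
    congr 1
    simp only [← Matrix.mul_assoc, diagonal_mul_diagonal]
    congr 2
    ext e
    rw [mul_left_comm, Real.mul_self_sqrt (hw e)]
  have det_gram : (C * Cᵀ).det = ∑ T ∈ F, ∏ e ∈ T, w e := by
    simpa [hB] using congrArg det (mul_diagonal_mul 1)
  have isUnit_det : IsUnit (C * Cᵀ).det := isUnit_iff_ne_zero.2 (det_gram ▸ hZ)
  refine ⟨Cᵀ * (C * Cᵀ)⁻¹ * C, fun T => ?_, fun T hT => ?_, ⟨?_, ?_⟩, fun s => ?_⟩
  · rw [productLaw]
    split_ifs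
    · exact div_nonneg (Finset.prod_nonneg fun e _ => hw e)
        (Finset.sum_nonneg fun T' _ => Finset.prod_nonneg fun e _ => hw e)
    · rfl
  · exact hF T <| by_contra fun h => hT (if_neg h)
  · calc Cᵀ * (C * Cᵀ)⁻¹ * C * (Cᵀ * (C * Cᵀ)⁻¹ * C)
        = Cᵀ * ((C * Cᵀ)⁻¹ * (C * Cᵀ)) * (C * Cᵀ)⁻¹ * C := by simp only [Matrix.mul_assoc]
      _ = Cᵀ * (C * Cᵀ)⁻¹ * C := by rw [nonsing_inv_mul _ isUnit_det, Matrix.mul_one]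
  · rw [IsSelfAdjoint, star_eq_conjTranspose, conjTranspose_eq_transpose_of_trivial]
    simp only [transpose_mul, transpose_transpose, transpose_nonsing_inv, Matrix.mul_assoc]
  · have add_mul_eq : C * diagonal s * Cᵀ =
        C * Cᵀ + (C * diagonal fun e => s e - 1) * Cᵀ := by
      rw [← Matrix.add_mul]
      congr 1
      ext i e
      rw [Matrix.add_apply, mul_diagonal, mul_diagonal]
      ring
    simp only [sum_productLaw_mul, ← Finset.prod_mul_distrib, mul_comm (w _)]
    rw [← hB, ← mul_diagonal_mul, add_mul_eq, det_add_mul _ _ isUnit_det, det_gram,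
      mul_div_cancel_left₀ _ hZ]
    simp only [Matrix.mul_assoc]

end DeterminantalLaws

section PairSplitting

open Matrix

variable {α : Type*} [DecidableEq α]

theorem ite_card_inter_pair_eq_one {a b : α} (hab : a ≠ b) (T : Finset α) :
    (if (T ∩ {a, b}).card = 1 then (1 : ℝ) else 0) =
      (1 - (if a ∈ T then -1 else 1) * (if b ∈ T then -1 else 1)) / 2 := by
  by_cases ha : a ∈ T <;> by_cases hb : b ∈ T <;>
    simp [ha, hb, hab, Finset.inter_insert_of_mem, Finset.inter_insert_of_notMem]

variable [Fintype α] {p : Finset α → ℝ} {E : Finset α}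
  {K : Matrix α α ℝ}

theorem IsDeterminantal.sum_mul_prod_sign {ι : Type*} [Fintype ι] [DecidableEq ι]
    (h : IsDeterminantal p E K) {a : ι → α} (ha : Function.Injective a) :
    ∑ T, p T * ∏ i, (if a i ∈ T then -1 else 1) = (1 - (2 : ℝ) • K.submatrix a a).det := by
  rw [h.sum_mul_prod_ite ha fun _ => -1]
  congr 1
  ext i j
  rw [Matrix.add_apply, Matrix.sub_apply, mul_diagonal, Matrix.smul_apply, smul_eq_mul]
  ring

theorem IsDeterminantal.sum_mul_sign_pair (h : IsDeterminantal p E K) {a b : α} (hab : a ≠ b)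
    (ha : K a a = 1 / 2) (hb : K b b = 1 / 2) :
    ∑ T, p T * ((if a ∈ T then -1 else 1) * (if b ∈ T then -1 else 1)) = -4 * K a b ^ 2 := by
  have injective : Function.Injective ![a, b] := by
    simpa [Function.Injective, Fin.forall_fin_two, eq_comm] using hab
  have matrix_eq : 1 - (2 : ℝ) • K.submatrix ![a, b] ![a, b] =
      !![0, -2 * K a b; -2 * K a b, 0] := by
    ext i j
    rw [Matrix.sub_apply, Matrix.smul_apply, submatrix_apply]
    fin_cases i <;> fin_cases j <;> simp [ha, hb, h.apply_comm b a]
  have moment := h.sum_mul_prod_sign injective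
  simp only [Fin.prod_univ_two] at moment
  refine moment.trans ?_
  rw [matrix_eq, det_fin_two_of]
  ring

theorem IsDeterminantal.sum_mul_sign_four (h : IsDeterminantal p E K) {a : Fin 4 → α}
    (ha : Function.Injective a) (hK : ∀ i, K (a i) (a i) = 1 / 2) :
    ∑ T, p T * (((if a 0 ∈ T then -1 else 1) * (if a 1 ∈ T then -1 else 1)) *
        ((if a 2 ∈ T then -1 else 1) * (if a 3 ∈ T then -1 else 1))) =
      16 * ((K (a 0) (a 1) * K (a 2) (a 3)) ^ 2 +
        (K (a 0) (a 2) * K (a 1) (a 3) - K (a 0) (a 3) * K (a 1) (a 2)) ^ 2 -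
        2 * (K (a 0) (a 1) * K (a 2) (a 3)) *
          (K (a 0) (a 2) * K (a 1) (a 3) + K (a 0) (a 3) * K (a 1) (a 2))) := by
  have matrix_eq : 1 - (2 : ℝ) • K.submatrix a a = (-2 : ℝ) •
      !![0, K (a 0) (a 1), K (a 0) (a 2), K (a 0) (a 3);
        K (a 0) (a 1), 0, K (a 1) (a 2), K (a 1) (a 3);
        K (a 0) (a 2), K (a 1) (a 2), 0, K (a 2) (a 3);
        K (a 0) (a 3), K (a 1) (a 3), K (a 2) (a 3), 0] := by
    ext i j
    rw [Matrix.sub_apply, Matrix.smul_apply, submatrix_apply]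
    fin_cases i <;> fin_cases j <;>
      simp [hK, h.apply_comm (a 1) (a 0), h.apply_comm (a 2) (a 0), h.apply_comm (a 3) (a 0),
        h.apply_comm (a 2) (a 1), h.apply_comm (a 3) (a 1), h.apply_comm (a 3) (a 2)]
  have moment := h.sum_mul_prod_sign ha
  simp only [Fin.prod_univ_four, mul_assoc] at moment ⊢
  rw [moment, matrix_eq, det_smul, det_succ_row_zero]
  simp [Fin.sum_univ_succ, det_fin_three, Fin.succAbove]
  ring

theorem eight_mul_mul_le_add_sq {p q r s t u : ℝ} (h₁ : p ^ 2 + r ^ 2 + s ^ 2 ≤ 1 / 4)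
    (h₂ : p ^ 2 + t ^ 2 + u ^ 2 ≤ 1 / 4) :
    8 * (p * q) * (r * u + s * t) ≤ p ^ 2 + q ^ 2 := by
  have abs_le_half : |2 * (r * u + s * t)| ≤ 1 / 2 := by
    rw [abs_le]
    constructor <;>
      nlinarith [sq_nonneg (r + u), sq_nonneg (s + t), sq_nonneg (r - u), sq_nonneg (s - t),
        sq_nonneg p]
  have two_mul_abs_le : 2 * |p * q| ≤ p ^ 2 + q ^ 2 := by
    rw [abs_mul]
    nlinarith [sq_nonneg (|p| - |q|), sq_abs p, sq_abs q]
  calc 8 * (p * q) * (r * u + s * t) = 4 * (p * q * (2 * (r * u + s * t))) := by ring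
    _ ≤ 4 * (|p * q| * |2 * (r * u + s * t)|) := by
        rw [← abs_mul]
        gcongr
        exact le_abs_self _
    _ ≤ 4 * (|p * q| * (1 / 2)) := by gcongr
    _ ≤ p ^ 2 + q ^ 2 := by linarith

theorem IsDeterminantal.sum_sq_le (h : IsDeterminantal p E K) {a : Fin 4 → α}
    (ha : Function.Injective a) (i : Fin 4) : ∑ j, K (a i) (a j) ^ 2 ≤ K (a i) (a i) := by
  rw [← h.sum_sq_eq (a i), ← Finset.sum_image (f := fun b => K (a i) b ^ 2) ha.injOn]
  exact Finset.sum_le_sum_of_subset_of_nonneg (Finset.subset_univ _) fun _ _ _ => sq_nonneg _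

theorem IsDeterminantal.quarter_le_sum_split_four (h : IsDeterminantal p E K) {a : Fin 4 → α}
    (ha : Function.Injective a) (hK : ∀ i, K (a i) (a i) = 1 / 2) :
    1 / 4 ≤ ∑ T with (T ∩ {a 0, a 1}).card = 1 ∧ (T ∩ {a 2, a 3}).card = 1, p T := by
  have h01 : a 0 ≠ a 1 := ha.ne (by decide)
  have h23 : a 2 ≠ a 3 := ha.ne (by decide)
  have term_eq (T : Finset α) :
      (if (T ∩ {a 0, a 1}).card = 1 ∧ (T ∩ {a 2, a 3}).card = 1 then p T else 0) =
        (p T - p T * ((if a 0 ∈ T then -1 else 1) * (if a 1 ∈ T then -1 else 1)) -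
          p T * ((if a 2 ∈ T then -1 else 1) * (if a 3 ∈ T then -1 else 1)) +
          p T * (((if a 0 ∈ T then -1 else 1) * (if a 1 ∈ T then -1 else 1)) *
            ((if a 2 ∈ T then -1 else 1) * (if a 3 ∈ T then -1 else 1)))) / 4 := by
    rw [← mul_one (p T), ← mul_zero (p T), ← mul_ite, ite_and, ← mul_boole,
      ite_card_inter_pair_eq_one h01, ite_card_inter_pair_eq_one h23]
    ring
  have row_zero := h.sum_sq_le ha 0
  have row_one := h.sum_sq_le ha 1
  rw [hK, Fin.sum_univ_four, hK] at row_zero row_one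
  rw [h.apply_comm (a 1) (a 0)] at row_one
  have mul_mul_le := eight_mul_mul_le_add_sq (q := K (a 2) (a 3))
    (by linarith : K (a 0) (a 1) ^ 2 + K (a 0) (a 2) ^ 2 + K (a 0) (a 3) ^ 2 ≤ 1 / 4)
    (by linarith : K (a 0) (a 1) ^ 2 + K (a 1) (a 2) ^ 2 + K (a 1) (a 3) ^ 2 ≤ 1 / 4)
  rw [Finset.sum_filter, Finset.sum_congr rfl fun T _ => term_eq T, ← Finset.sum_div,
    Finset.sum_add_distrib, Finset.sum_sub_distrib, Finset.sum_sub_distrib, h.sum_eq_one,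
    h.sum_mul_sign_pair h01 (hK 0) (hK 1), h.sum_mul_sign_pair h23 (hK 2) (hK 3),
    h.sum_mul_sign_four ha hK]
  linarith [sq_nonneg (K (a 0) (a 1) * K (a 2) (a 3)),
    sq_nonneg (K (a 0) (a 2) * K (a 1) (a 3) - K (a 0) (a 3) * K (a 1) (a 2))]

theorem IsDeterminantal.quarter_le_sum_split (h : IsDeterminantal p E K) {D₁ D₂ : Finset α}
    (hD : Disjoint D₁ D₂) (h₁ : D₁.card = 2) (h₂ : D₂.card = 2)
    (hK : ∀ e ∈ D₁ ∪ D₂, K e e = 1 / 2) :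
    1 / 4 ≤ ∑ T with (T ∩ D₁).card = 1 ∧ (T ∩ D₂).card = 1, p T := by
  obtain ⟨a, b, hab, rfl⟩ := Finset.card_eq_two.1 h₁
  obtain ⟨c, d, hcd, rfl⟩ := Finset.card_eq_two.1 h₂
  refine h.quarter_le_sum_split_four (a := ![a, b, c, d]) ?_ fun i =>
    hK _ (by fin_cases i <;> simp)
  simp only [Finset.disjoint_insert_left, Finset.disjoint_singleton_left, Finset.mem_insert,
    Finset.mem_singleton, not_or] at hD
  intro i j hij
  fin_cases i <;> fin_cases j <;> simp_all

end PairSplitting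

section Transversals

open Matrix

variable {α : Type*} [DecidableEq α] {𝒟 : Finset (Finset α)}

/-- The sets that consist of one element of each member of the disjoint family `𝒟`. -/
def transversals (𝒟 : Finset (Finset α)) : Finset (Finset α) :=
  (𝒟.biUnion id).powerset.filter fun T => ∀ D ∈ 𝒟, (T ∩ D).card = 1

theorem mem_transversals {T : Finset α} :
    T ∈ transversals 𝒟 ↔ T ⊆ 𝒟.biUnion id ∧ ∀ D ∈ 𝒟, (T ∩ D).card = 1 := by
  rw [transversals, Finset.mem_filter, Finset.mem_powerset]

theorem image_inter_eq_singleton (h𝒟 : (𝒟 : Set (Finset α)).PairwiseDisjoint id) {φ : 𝒟 → α}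
    (hφ : ∀ D, φ D ∈ D.1) (D : 𝒟) : Finset.univ.image φ ∩ D.1 = {φ D} := by
  ext a
  simp only [Finset.mem_inter, Finset.mem_image, Finset.mem_univ, true_and,
    Finset.mem_singleton]
  constructor
  · rintro ⟨⟨D', rfl⟩, hD'⟩
    rw [Subtype.ext (h𝒟.elim_finset D'.2 D.2 _ (hφ D') hD')]
  · rintro rfl
    exact ⟨⟨D, rfl⟩, hφ D⟩

theorem sum_transversals_prod {R : Type*} [CommRing R]
    (h𝒟 : (𝒟 : Set (Finset α)).PairwiseDisjoint id) (s : α → R) :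
    ∑ T ∈ transversals 𝒟, ∏ e ∈ T, s e = ∏ D ∈ 𝒟, ∑ e ∈ D, s e := by
  rw [← Finset.prod_coe_sort, Finset.prod_univ_sum]
  symm
  refine Finset.sum_bij (fun φ _ => Finset.univ.image φ) (fun φ hφ => ?_)
    (fun φ hφ ψ hψ heq => ?_) (fun T hT => ?_) (fun φ hφ => ?_)
  all_goals simp only [Fintype.mem_piFinset] at *
  · refine mem_transversals.2 ⟨?_, fun D hD => ?_⟩
    · exact Finset.image_subset_iff.2 fun D _ => Finset.mem_biUnion.2 ⟨D.1, D.2, hφ D⟩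
    · rw [image_inter_eq_singleton h𝒟 hφ ⟨D, hD⟩, Finset.card_singleton]
  · ext D
    rw [← Finset.singleton_inj, ← image_inter_eq_singleton h𝒟 hφ, heq,
      image_inter_eq_singleton h𝒟 hψ]
  · obtain ⟨hsub, hcard⟩ := mem_transversals.1 hT
    choose φ hφ using fun D : 𝒟 => Finset.card_eq_one.1 (hcard D.1 D.2)
    have mem_inter (D : 𝒟) : φ D ∈ T ∩ D.1 := hφ D ▸ Finset.mem_singleton_self _
    refine ⟨φ, fun D => (Finset.mem_inter.1 (mem_inter D)).2, ?_⟩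
    ext a
    simp only [Finset.mem_image, Finset.mem_univ, true_and]
    constructor
    · rintro ⟨D, rfl⟩
      exact (Finset.mem_inter.1 (mem_inter D)).1
    · intro ha
      obtain ⟨D, hD, haD⟩ := Finset.mem_biUnion.1 (hsub ha)
      exact ⟨⟨D, hD⟩, (Finset.mem_singleton.1 (hφ ⟨D, hD⟩ ▸ Finset.mem_inter.2 ⟨ha, haD⟩)).symm⟩
  · refine (Finset.prod_image fun D _ D' _ heq => ?_).symm
    exact Subtype.ext (h𝒟.elim_finset D.2 D'.2 _ (hφ D) (heq ▸ hφ D'))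

variable [Fintype α]

theorem det_indicator_mul_diagonal_mul_transpose {R : Type*} [CommRing R]
    (h𝒟 : (𝒟 : Set (Finset α)).PairwiseDisjoint id) (s : α → R) :
    let B : Matrix 𝒟 α R := of fun D e => if e ∈ D.1 then 1 else 0
    (B * diagonal s * Bᵀ).det = ∏ D ∈ 𝒟, ∑ e ∈ D, s e := by
  intro B
  have gram_eq : B * diagonal s * Bᵀ = diagonal fun D : 𝒟 => ∑ e ∈ D.1, s e := by
    ext D D'
    have summand_eq (e : α) : (B * diagonal s) D e * Bᵀ e D' =
        if e ∈ D.1 ∩ D'.1 then s e else 0 := by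
      simp only [B, mul_diagonal, transpose_apply, of_apply, ite_mul, one_mul, zero_mul, mul_ite,
        mul_one, mul_zero, Finset.mem_inter, ← ite_and, and_comm]
    rw [mul_apply, Finset.sum_congr rfl fun e _ => summand_eq e, Finset.sum_ite_mem,
      Finset.univ_inter]
    obtain rfl | hne := eq_or_ne D D'
    · rw [Finset.inter_self, diagonal_apply_eq]
    · have inter_eq : D.1 ∩ D'.1 = ∅ := Finset.disjoint_iff_inter_eq_empty.1 <|
        h𝒟 D.2 D'.2 (Subtype.coe_injective.ne hne)
      rw [diagonal_apply_ne _ hne, inter_eq, Finset.sum_empty]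
  rw [gram_eq, det_diagonal, Finset.prod_coe_sort 𝒟 fun D => ∑ e ∈ D, s e]

theorem sum_productLaw_transversals_notMem (h𝒟 : (𝒟 : Set (Finset α)).PairwiseDisjoint id)
    (h𝒟₀ : ∅ ∉ 𝒟) {D : Finset α} (hD : D ∈ 𝒟) {e : α} (he : e ∈ D) :
    ∑ T with e ∉ T, productLaw (transversals 𝒟) 1 T = 1 - (D.card : ℝ)⁻¹ := by
  set s : α → ℝ := Function.update 1 e 0 with hs
  have prod_eq (T : Finset α) : ∏ a ∈ T, s a = if e ∈ T then 0 else 1 := by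
    split_ifs with heT
    · exact Finset.prod_eq_zero heT (Function.update_self ..)
    · exact Finset.prod_eq_one fun a ha =>
        Function.update_of_ne (ne_of_mem_of_not_mem ha heT) ..
  have card_ne_zero {D' : Finset α} (hD' : D' ∈ 𝒟) : (D'.card : ℝ) ≠ 0 := by
    rw [Nat.cast_ne_zero, Ne, Finset.card_eq_zero]
    exact fun h => h𝒟₀ (h ▸ hD')
  have sum_eq_card {D' : Finset α} (heD' : e ∉ D') : ∑ a ∈ D', s a = D'.card := by
    rw [Finset.sum_congr rfl fun a ha => Function.update_of_ne (ne_of_mem_of_not_mem ha heD') ..]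
    simp
  have sum_eq_card_sub : ∑ a ∈ D, s a = D.card - 1 := by
    rw [← Finset.add_sum_erase D s he, hs, Function.update_self, zero_add, ← hs,
      sum_eq_card (Finset.notMem_erase e D), Finset.cast_card_erase_of_mem he]
  calc ∑ T with e ∉ T, productLaw (transversals 𝒟) 1 T
      = ∑ T, productLaw (transversals 𝒟) 1 T * ∏ a ∈ T, s a := by
        simp [prod_eq, Finset.sum_filter]
    _ = (∑ T ∈ transversals 𝒟, ∏ a ∈ T, s a) / ∑ T ∈ transversals 𝒟, ∏ a ∈ T, 1 := by
        simp only [sum_productLaw_mul, Pi.one_apply, Finset.prod_const_one, one_mul]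
    _ = (∏ D' ∈ 𝒟, ∑ a ∈ D', s a) / ∏ D' ∈ 𝒟, (D'.card : ℝ) := by
        simp only [sum_transversals_prod h𝒟, Finset.card_eq_sum_ones, Nat.cast_sum, Nat.cast_one]
    _ = ∏ D' ∈ 𝒟, (∑ a ∈ D', s a) / D'.card := Finset.prod_div_distrib .. |>.symm
    _ = (∑ a ∈ D, s a) / D.card := by
        refine Finset.prod_eq_single_of_mem D hD fun D' hD' hne => ?_
        have heD' : e ∉ D' := fun heD' => hne (h𝒟.elim_finset hD' hD e heD' he)
        rw [sum_eq_card heD', div_self (card_ne_zero hD')]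
    _ = 1 - (D.card : ℝ)⁻¹ := by
        rw [sum_eq_card_sub, sub_div, div_self (card_ne_zero hD), one_div]

theorem exists_isDeterminantal_transversals (h𝒟 : (𝒟 : Set (Finset α)).PairwiseDisjoint id)
    (h𝒟₀ : ∅ ∉ 𝒟) :
    ∃ K, IsDeterminantal (productLaw (transversals 𝒟) 1) (𝒟.biUnion id) K ∧
      ∀ D ∈ 𝒟, ∀ e ∈ D, K e e = (D.card : ℝ)⁻¹ := by
  have sum_ne_zero : ∑ T ∈ transversals 𝒟, ∏ e ∈ T, (1 : α → ℝ) e ≠ 0 := by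
    rw [sum_transversals_prod h𝒟]
    refine Finset.prod_ne_zero_iff.2 fun D hD => ?_
    have : D ≠ ∅ := fun h => h𝒟₀ (h ▸ hD)
    simpa using this
  obtain ⟨K, hK⟩ := exists_isDeterminantal_productLaw
    (fun s => (det_indicator_mul_diagonal_mul_transpose h𝒟 s).trans
      (sum_transversals_prod h𝒟 s).symm)
    (w := 1) (fun T hT => (mem_transversals.1 hT).1) (fun _ => zero_le_one) sum_ne_zero
  refine ⟨K, hK, fun D hD e he => ?_⟩
  linarith [hK.sum_filter_notMem e, sum_productLaw_transversals_notMem h𝒟 h𝒟₀ hD he]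

end Transversals

section MatrixTree

open Matrix

variable {V : Type*} {e : Edge V} {X Y : Finset V}

open Classical in
/-- The edges of `G` between `X` and `Y`. -/
noncomputable def joinEdges (G : Finset (Edge V)) (X Y : Finset V) : Finset (Edge V) :=
  G.filter fun e => Joins e X Y

open Classical in
theorem mem_joinEdges {G : Finset (Edge V)} : e ∈ joinEdges G X Y ↔ e ∈ G ∧ Joins e X Y :=
  Finset.mem_filter

theorem Joins.symm (h : Joins e X Y) : Joins e Y X := by
  obtain ⟨u, hu, v, hv, he⟩ := h
  exact ⟨v, hv, u, hu, he.trans Sym2.eq_swap⟩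

theorem mem_iff_eq_of_pairwiseDisjoint {A : Finset (Finset V)}
    (hA : (A : Set (Finset V)).PairwiseDisjoint id) (hX : X ∈ A) (hY : Y ∈ A) {u : V}
    (hu : u ∈ X) : u ∈ Y ↔ Y = X :=
  ⟨fun h => hA.elim_finset hY hX u h hu, fun h => h ▸ hu⟩

variable [DecidableEq V] {G T : Finset (Edge V)} {A : Finset (Finset V)} {X₀ : Finset V}

theorem connects_iff :
    Connects T A ↔ ∀ C ⊆ A, C.Nonempty → (A \ C).Nonempty →
      ∃ e ∈ T, ∃ X ∈ C, ∃ Y ∈ A \ C, Joins e X Y := by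
  constructor
  · rintro hT C hC ⟨X, hX⟩ ⟨Y, hY⟩
    by_contra! hcut
    have mem_of_path {Z : Finset V} (hZ : Relation.ReflTransGen
        (fun X' Y' => X' ∈ A ∧ Y' ∈ A ∧ ∃ e ∈ T, Joins e X' Y') X Z) : Z ∈ C := by
      induction hZ with
      | refl => exact hX
      | tail _ h ih =>
        obtain ⟨-, hZ', e, he, hJ⟩ := h
        by_contra hZC
        exact hcut e he _ ih _ (Finset.mem_sdiff.2 ⟨hZ', hZC⟩) hJ
    exact (Finset.mem_sdiff.1 hY).2 (mem_of_path (hT X (hC hX) Y (Finset.mem_sdiff.1 hY).1))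
  · classical
    intro h X hX Y hY
    by_contra hXY
    obtain ⟨e, he, Z, hZ, W, hW, hJ⟩ := h
      (A.filter fun Z => Relation.ReflTransGen
        (fun X' Y' => X' ∈ A ∧ Y' ∈ A ∧ ∃ e ∈ T, Joins e X' Y') X Z)
      (Finset.filter_subset _ _) ⟨X, Finset.mem_filter.2 ⟨hX, .refl⟩⟩
      ⟨Y, Finset.mem_sdiff.2 ⟨hY, fun h => hXY (Finset.mem_filter.1 h).2⟩⟩
    obtain ⟨hZA, hZ⟩ := Finset.mem_filter.1 hZ
    obtain ⟨hWA, hW⟩ := Finset.mem_sdiff.1 hW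
    exact hW (Finset.mem_filter.2 ⟨hWA, hZ.tail ⟨hZA, hWA, e, he, hJ⟩⟩)

open Classical in
theorem mem_innerEdges :
    e ∈ innerEdges G A ↔ e ∈ G ∧ ∃ X ∈ A, ∃ Y ∈ A, X ≠ Y ∧ Joins e X Y :=
  Finset.mem_filter

/-- The incidence matrix of the contracted graph `(A, E(A))` without the row of `X₀`. The edges are
oriented by the choice of representatives `Quot.out`. -/
noncomputable def incidence (G : Finset (Edge V)) (A : Finset (Finset V)) (X₀ : Finset V) :
    Matrix (A.erase X₀) (Edge V) ℤ :=
  of fun Z e => if e ∈ innerEdges G A then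
    (if e.1.out.1 ∈ Z.1 then 1 else 0) - (if e.1.out.2 ∈ Z.1 then 1 else 0) else 0

theorem exists_incidence_apply_eq (hA : (A : Set (Finset V)).PairwiseDisjoint id)
    (he : e ∈ innerEdges G A) (hX : X ∈ A) (hY : Y ∈ A) (h : Joins e X Y) :
    ∃ ε : ℤˣ, ∀ Z : A.erase X₀, incidence G A X₀ Z e =
      ε * ((if Z.1 = X then 1 else 0) - (if Z.1 = Y then 1 else 0)) := by
  obtain ⟨u, hu, v, hv, huv⟩ := h
  have out_eq : s(e.1.out.1, e.1.out.2) = s(u, v) := (Quot.out_eq e.1).trans huv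
  have mem_iff (Z : A.erase X₀) : (u ∈ Z.1 ↔ Z.1 = X) ∧ (v ∈ Z.1 ↔ Z.1 = Y) :=
    have hZ := Finset.mem_of_mem_erase Z.2
    ⟨mem_iff_eq_of_pairwiseDisjoint hA hX hZ hu, mem_iff_eq_of_pairwiseDisjoint hA hY hZ hv⟩
  obtain ⟨h₁, h₂⟩ | ⟨h₁, h₂⟩ := Sym2.eq_iff.1 out_eq
  · exact ⟨1, fun Z => by simp [incidence, he, h₁, h₂, mem_iff]⟩
  · exact ⟨-1, fun Z => by simp [incidence, he, h₁, h₂, mem_iff]⟩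

open Classical in
/-- The signed sum of the columns along a path from `X₀` to `X` is the unit vector of `X`. -/
theorem exists_incidence_mulVec_eq (hA : (A : Set (Finset V)).PairwiseDisjoint id) (hX₀ : X₀ ∈ A)
    (hT : T ⊆ innerEdges G A) (hconn : Connects T A) {ι : Type*} [Fintype ι] {φ : ι → Edge V}
    (hφ : Finset.univ.image φ = T) (hX : X ∈ A) :
    ∃ c : ι → ℤ, (incidence G A X₀).submatrix id φ *ᵥ c = fun Z => if Z.1 = X then 1 else 0 := by
  induction hconn X₀ hX₀ X hX with
  | refl =>
    refine ⟨0, funext fun Z => ?_⟩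
    rw [mulVec_zero, Pi.zero_apply, if_neg (Finset.ne_of_mem_erase Z.2)]
  | @tail X' Y' _ h ih =>
    obtain ⟨hX', hY', e, heT, hJ⟩ := h
    obtain ⟨c, hc⟩ := ih hX'
    obtain ⟨i, -, rfl⟩ := Finset.mem_image.1 (hφ.symm ▸ heT : e ∈ Finset.univ.image φ)
    obtain ⟨ε, hε⟩ := exists_incidence_apply_eq (X₀ := X₀) hA (hT heT) hX' hY' hJ
    refine ⟨c - Pi.single i (ε : ℤ), funext fun Z => ?_⟩
    rw [mulVec_sub, hc, mulVec_single, Pi.sub_apply, Pi.smul_apply, col_apply, submatrix_apply,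
      id_eq, hε, MulOpposite.smul_eq_mul_unop, MulOpposite.unop_op, mul_right_comm, ← Units.val_mul,
      Int.units_mul_self, Units.val_one, one_mul]
    ring

theorem isUnit_det_incidence (hA : (A : Set (Finset V)).PairwiseDisjoint id) (hX₀ : X₀ ∈ A)
    (hT : IsSpanningTree G A T) {φ : A.erase X₀ → Edge V} (hφ : Finset.univ.image φ = T) :
    IsUnit ((incidence G A X₀).submatrix id φ).det := by
  choose c hc using fun X : A.erase X₀ =>
    exists_incidence_mulVec_eq hA hX₀ hT.1 hT.2.1 hφ (Finset.mem_of_mem_erase X.2)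
  refine isUnit_det_of_right_inverse (B := of fun i X => c X i) ?_
  ext Z X
  exact (congrFun (hc X) Z).trans <| by simp only [one_apply, Subtype.ext_iff]

/-- If no edge leaves `C`, then the rows of the nodes in `C`, or those of the other nodes when `C`
contains `X₀`, sum to zero. -/
theorem det_incidence_eq_zero (hA : (A : Set (Finset V)).PairwiseDisjoint id) (hX₀ : X₀ ∈ A)
    {φ : A.erase X₀ → Edge V} (hφ : ∀ i, φ i ∈ innerEdges G A)
    (hconn : ¬ Connects (Finset.univ.image φ) A) :
    ((incidence G A X₀).submatrix id φ).det = 0 := by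
  rw [connects_iff] at hconn
  push Not at hconn
  obtain ⟨C, hC, ⟨X, hX⟩, ⟨Y, hY⟩, hcut⟩ := hconn
  have mem_iff_mem {i : A.erase X₀} {Z W : Finset V} (hZ : Z ∈ A) (hW : W ∈ A)
      (hJ : Joins (φ i) Z W) : Z ∈ C ↔ W ∈ C := by
    have hi : φ i ∈ Finset.univ.image φ := Finset.mem_image_of_mem _ (Finset.mem_univ i)
    constructor <;> intro hmem <;> by_contra hnot
    · exact hcut _ hi _ hmem _ (Finset.mem_sdiff.2 ⟨hW, hnot⟩) hJ
    · exact hcut _ hi _ hmem _ (Finset.mem_sdiff.2 ⟨hZ, hnot⟩) hJ.symm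
  set y : Finset V → ℤ := fun Z => (if Z ∈ C then 1 else 0) - if X₀ ∈ C then 1 else 0 with hy
  have sum_eq {W : Finset V} (hW : W ∈ A) :
      ∑ Z : A.erase X₀, y Z * (if Z.1 = W then 1 else 0) = y W := by
    simp only [mul_ite, mul_one, mul_zero]
    rw [Finset.sum_coe_sort (A.erase X₀) fun Z => if Z = W then y Z else 0, Finset.sum_ite_eq']
    refine ite_eq_left_iff.2 fun hW' => ?_
    have hWX₀ : W = X₀ := by_contra fun hne => hW' (Finset.mem_erase.2 ⟨hne, hW⟩)
    rw [hWX₀]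
    exact (sub_self _).symm
  obtain ⟨Z, hZ, hyZ⟩ : ∃ Z ∈ A, y Z ≠ 0 := by
    by_cases hX₀C : X₀ ∈ C
    · exact ⟨Y, (Finset.mem_sdiff.1 hY).1, by simp [hy, hX₀C, (Finset.mem_sdiff.1 hY).2]⟩
    · exact ⟨X, hC hX, by simp [hy, hX₀C, hX]⟩
  have hZX₀ : Z ≠ X₀ := by
    rintro rfl
    exact hyZ (sub_self _)
  rw [← exists_vecMul_eq_zero_iff]
  refine ⟨fun Z => y Z, fun h => hyZ (congrFun h ⟨Z, Finset.mem_erase.2 ⟨hZX₀, hZ⟩⟩), ?_⟩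
  ext i
  obtain ⟨-, Z, hZ, W, hW, -, hJ⟩ := mem_innerEdges.1 (hφ i)
  obtain ⟨ε, hε⟩ := exists_incidence_apply_eq (X₀ := X₀) hA (hφ i) hZ hW hJ
  have hyZW : y Z = y W := by simp only [hy, mem_iff_mem hZ hW hJ]
  rw [vecMul, Pi.zero_apply, dotProduct]
  simp only [submatrix_apply, id_eq, hε, mul_left_comm _ (ε : ℤ), ← Finset.mul_sum, mul_sub,
    Finset.sum_sub_distrib, sum_eq hZ, sum_eq hW, hyZW, sub_self]

/-- Two edges between `X` and `Y` would give proportional columns of the matrix without the row of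
`X`. -/
theorem IsSpanningTree.card_joinEdges_le_one (hA : (A : Set (Finset V)).PairwiseDisjoint id)
    (hT : IsSpanningTree G A T) (hX : X ∈ A) (hY : Y ∈ A) : (joinEdges T X Y).card ≤ 1 := by
  refine Finset.card_le_one.2 fun a ha b hb => ?_
  obtain ⟨⟨ha, hJa⟩, hb, hJb⟩ := And.intro (mem_joinEdges.1 ha) (mem_joinEdges.1 hb)
  by_contra hab
  obtain ⟨φ, hφ⟩ := Function.Embedding.exists_of_card_eq_finset (α := A.erase X) (s := T) <| by
    rw [Fintype.card_coe, Finset.card_erase_of_mem hX, ← hT.2.2, Nat.add_sub_cancel]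
  obtain ⟨i, -, rfl⟩ := Finset.mem_map.1 (hφ ▸ ha)
  obtain ⟨j, -, rfl⟩ := Finset.mem_map.1 (hφ ▸ hb)
  obtain ⟨ε, hε⟩ := exists_incidence_apply_eq (X₀ := X) hA (hT.1 ha) hX hY hJa
  obtain ⟨δ, hδ⟩ := exists_incidence_apply_eq (X₀ := X) hA (hT.1 hb) hX hY hJb
  have hij : i ≠ j := fun h => hab (congrArg φ h)
  refine (isUnit_det_incidence (φ := φ) hA hX hT <| by rw [← hφ, Finset.map_eq_image]).ne_zero ?_
  rw [← exists_mulVec_eq_zero_iff]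
  refine ⟨Pi.single i (ε : ℤ) - Pi.single j (δ : ℤ), fun h => ?_, funext fun Z => ?_⟩
  · have := congrFun h i
    rw [Pi.sub_apply, Pi.single_eq_same, Pi.single_eq_of_ne hij, sub_zero] at this
    exact ε.ne_zero this
  · simp only [mulVec_sub, mulVec_single, Pi.sub_apply, Pi.smul_apply, col_apply, submatrix_apply,
      id_eq, hε, hδ, MulOpposite.smul_eq_mul_unop, MulOpposite.unop_op, Pi.zero_apply]
    rw [mul_right_comm, mul_right_comm (δ : ℤ), ← Units.val_mul, ← Units.val_mul,
      Int.units_mul_self, Int.units_mul_self, sub_self]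

open Classical in
theorem det_incidence_sq (hA : (A : Set (Finset V)).PairwiseDisjoint id) (hX₀ : X₀ ∈ A)
    {φ : A.erase X₀ → Edge V} (hφ : Function.Injective φ) :
    ((incidence G A X₀).submatrix id φ).det ^ 2 =
      if IsSpanningTree G A (Finset.univ.image φ) then 1 else 0 := by
  split_ifs with hT
  · exact Int.isUnit_sq (isUnit_det_incidence hA hX₀ hT rfl)
  · refine pow_eq_zero_iff two_ne_zero |>.2 ?_
    by_cases hinner : ∀ i, φ i ∈ innerEdges G A
    · refine det_incidence_eq_zero hA hX₀ hinner fun hconn => hT ⟨?_, hconn, ?_⟩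
      · exact Finset.image_subset_iff.2 fun i _ => hinner i
      · rw [Finset.card_image_of_injective _ hφ, Finset.card_univ, Fintype.card_coe,
          Finset.card_erase_add_one hX₀]
    · push Not at hinner
      obtain ⟨i, hi⟩ := hinner
      exact det_eq_zero_of_column_eq_zero i fun Z => if_neg hi

variable [Fintype V]

open Classical in
/-- The weighted matrix-tree theorem. -/
theorem det_incidence_mul_diagonal_mul_transpose
    (hA : (A : Set (Finset V)).PairwiseDisjoint id) (hX₀ : X₀ ∈ A) (s : Edge V → ℝ) :
    let B := (incidence G A X₀).map (Int.cast : ℤ → ℝ)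
    (B * diagonal s * Bᵀ).det = ∑ T with IsSpanningTree G A T, ∏ e ∈ T, s e := by
  refine det_mul_diagonal_mul_transpose_eq_sum_prod _ _ (fun T hT => ?_) (fun φ hφ => ?_) s
  · rw [Fintype.card_coe, Finset.card_erase_of_mem hX₀, ← (Finset.mem_filter.1 hT).2.2.2,
      Nat.add_sub_cancel]
  · have det_map : (((incidence G A X₀).map (Int.cast : ℤ → ℝ)).submatrix id φ).det =
        (((incidence G A X₀).submatrix id φ).det : ℤ) := (Int.cast_det _).symm
    rw [det_map, ← Int.cast_pow, det_incidence_sq hA hX₀ hφ]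
    simp only [Finset.mem_filter_univ, Int.cast_ite, Int.cast_one, Int.cast_zero]

open Classical in
theorem IsMaxEntropy.exists_isDeterminantal {p : Finset (Edge V) → ℝ} (hp : IsMaxEntropy G A p)
    (hA : (A : Set (Finset V)).PairwiseDisjoint id) (hne : A.Nonempty) :
    ∃ K, IsDeterminantal p (innerEdges G A) K ∧ ∀ e ∈ innerEdges G A, K e e = 1 / 2 := by
  obtain ⟨⟨w, hw, hZ, hpw⟩, hmarginal⟩ := hp
  obtain ⟨X₀, hX₀⟩ := hne
  have hp : p = productLaw (Finset.univ.filter (IsSpanningTree G A)) w := by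
    ext T
    rw [hpw, productLaw]
    simp only [Finset.mem_filter_univ]
  obtain ⟨K, hK⟩ := exists_isDeterminantal_productLaw
    (det_incidence_mul_diagonal_mul_transpose hA hX₀)
    (fun T hT => (Finset.mem_filter.1 hT).2.1) hw hZ.ne'
  exact ⟨K, hp ▸ hK, fun e he => by rw [← hmarginal e he, hp, ← hK.sum_filter_mem]⟩

end MatrixTree

section Cuts

variable {V : Type*} {G T : Finset (Edge V)} {X Y Z W : Finset V}

theorem joinEdges_comm : joinEdges G X Y = joinEdges G Y X := by
  ext e
  simp only [mem_joinEdges]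
  exact and_congr_right fun _ => ⟨Joins.symm, Joins.symm⟩

theorem joinEdges_mono (hX : X ⊆ Z) (hY : Y ⊆ W) : joinEdges G X Y ⊆ joinEdges G Z W := by
  intro e he
  obtain ⟨heG, u, hu, v, hv, huv⟩ := mem_joinEdges.1 he
  exact mem_joinEdges.2 ⟨heG, u, hX hu, v, hY hv, huv⟩

theorem disjoint_joinEdges (hXY : Disjoint X Y) (hYZ : Disjoint Y Z) :
    Disjoint (joinEdges G X Y) (joinEdges G X Z) := by
  refine Finset.disjoint_left.2 fun e heY heZ => ?_
  obtain ⟨-, u, -, v, hv, huv⟩ := mem_joinEdges.1 heY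
  obtain ⟨-, u', hu', w, hw, huw⟩ := mem_joinEdges.1 heZ
  obtain ⟨-, rfl⟩ | ⟨-, rfl⟩ := Sym2.eq_iff.1 (huv.symm.trans huw)
  · exact Finset.disjoint_left.1 hYZ hv hw
  · exact Finset.disjoint_left.1 hXY hu' hv

variable [DecidableEq V]

theorem inter_joinEdges : T ∩ joinEdges G X Y = joinEdges (T ∩ G) X Y := by
  ext e
  simp only [Finset.mem_inter, mem_joinEdges, and_assoc]

theorem joinEdges_union_right :
    joinEdges G X (Y ∪ Z) = joinEdges G X Y ∪ joinEdges G X Z := by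
  ext e
  simp only [Finset.mem_union, mem_joinEdges, Joins, or_and_right, exists_or, and_or_left]

theorem card_joinEdges_union_right (hXY : Disjoint X Y) (hYZ : Disjoint Y Z) :
    (joinEdges G X (Y ∪ Z)).card = (joinEdges G X Y).card + (joinEdges G X Z).card := by
  rw [joinEdges_union_right, Finset.card_union_of_disjoint (disjoint_joinEdges hXY hYZ)]

theorem card_joinEdges_union_left (hXZ : Disjoint X Z) (hXY : Disjoint X Y) :
    (joinEdges G (X ∪ Y) Z).card = (joinEdges G X Z).card + (joinEdges G Y Z).card := by
  simp only [joinEdges_comm (Y := Z), card_joinEdges_union_right hXZ.symm hXY]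

variable [Fintype V]

theorem cut_eq_joinEdges : cut G X = joinEdges G X Xᶜ := rfl

theorem cut_compl : cut G Xᶜ = cut G X := by
  rw [cut_eq_joinEdges, compl_compl, joinEdges_comm, ← cut_eq_joinEdges]

theorem inter_cut : T ∩ cut G X = cut (T ∩ G) X := inter_joinEdges

theorem card_cut_inter (X Y : Finset V) : (cut G (X ∩ Y)).card =
    (joinEdges G (X ∩ Y) (X ∩ Yᶜ)).card + (joinEdges G (X ∩ Y) (Xᶜ ∩ Y)).card +
      (joinEdges G (X ∩ Y) (Xᶜ ∩ Yᶜ)).card := by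
  have compl_eq : (X ∩ Y)ᶜ = X ∩ Yᶜ ∪ Xᶜ ∩ Y ∪ Xᶜ ∩ Yᶜ := by
    ext v
    simp only [Finset.mem_compl, Finset.mem_inter, Finset.mem_union]
    tauto
  rw [cut_eq_joinEdges, compl_eq, card_joinEdges_union_right, card_joinEdges_union_right]
  all_goals
    refine Finset.disjoint_left.2 fun v => ?_
    simp only [Finset.mem_compl, Finset.mem_inter, Finset.mem_union]
    tauto

theorem card_cut_eq (X Y : Finset V) : (cut G X).card =
    (joinEdges G (X ∩ Y) (Xᶜ ∩ Y)).card + (joinEdges G (X ∩ Y) (Xᶜ ∩ Yᶜ)).card +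
      ((joinEdges G (X ∩ Yᶜ) (Xᶜ ∩ Y)).card + (joinEdges G (X ∩ Yᶜ) (Xᶜ ∩ Yᶜ)).card) := by
  have union_eq (Z : Finset V) : Z ∩ Y ∪ Z ∩ Yᶜ = Z := by
    rw [← Finset.inter_union_distrib_left, Finset.union_compl, Finset.inter_univ]
  have disjoint_compl (Z W : Finset V) : Disjoint (Z ∩ Y) (W ∩ Yᶜ) :=
    disjoint_compl_right.mono Finset.inter_subset_right Finset.inter_subset_right
  have disjoint_of_compl (Z W : Finset V) : Disjoint (X ∩ Z) (Xᶜ ∩ W) :=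
    disjoint_compl_right.mono Finset.inter_subset_left Finset.inter_subset_left
  rw [← card_joinEdges_union_right (disjoint_of_compl _ _) (disjoint_compl _ _),
    ← card_joinEdges_union_right (disjoint_of_compl _ _) (disjoint_compl _ _), union_eq,
    ← card_joinEdges_union_left (disjoint_compl_right.mono_left Finset.inter_subset_left)
      (disjoint_compl _ _), union_eq, ← cut_eq_joinEdges]

theorem card_cut_union (hXY : Disjoint X Y) : (cut G (X ∪ Y)).card +
    2 * (joinEdges G X Y).card = (cut G X).card + (cut G Y).card := by
  have compl_X : Xᶜ = Y ∪ (X ∪ Y)ᶜ := by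
    ext v
    have notMem (h : v ∈ X) : v ∉ Y := Finset.disjoint_left.1 hXY h
    simp only [Finset.mem_compl, Finset.mem_union]
    tauto
  have compl_Y : Yᶜ = X ∪ (X ∪ Y)ᶜ := by
    ext v
    have notMem (h : v ∈ X) : v ∉ Y := Finset.disjoint_left.1 hXY h
    simp only [Finset.mem_compl, Finset.mem_union]
    tauto
  have hX : Disjoint X (X ∪ Y)ᶜ := disjoint_compl_right.mono_left Finset.subset_union_left
  have hY : Disjoint Y (X ∪ Y)ᶜ := disjoint_compl_right.mono_left Finset.subset_union_right
  rw [cut_eq_joinEdges, card_joinEdges_union_left hX hXY, cut_eq_joinEdges (X := X), compl_X,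
    card_joinEdges_union_right hXY hY, cut_eq_joinEdges (X := Y), compl_Y,
    card_joinEdges_union_right hXY.symm hX, joinEdges_comm (X := Y) (Y := X)]
  ring

/-- Every cut has at least four edges. -/
def IsFourEdgeConnected (G : Finset (Edge V)) : Prop :=
  ∀ X : Finset V, X.Nonempty → X ≠ Finset.univ → 4 ≤ (cut G X).card

/-- The cuts of the four corners have `16` edges in total, less twice the number of edges between
opposite corners. -/
theorem IsFourEdgeConnected.corners (hG : IsFourEdgeConnected G) (hX : (cut G X).card = 4)
    (hY : (cut G Y).card = 4) (h₁ : (X ∩ Y).Nonempty) (h₂ : (X ∩ Yᶜ).Nonempty)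
    (h₃ : (Xᶜ ∩ Y).Nonempty) (h₄ : (Xᶜ ∩ Yᶜ).Nonempty) :
    (cut G (X ∩ Y)).card = 4 ∧ (joinEdges G (X ∩ Y) (X ∩ Yᶜ)).card = 2 ∧
      joinEdges G (X ∩ Yᶜ) (Xᶜ ∩ Y) = ∅ := by
  have four_le {Z W : Finset V} (hZ : Z.Nonempty) (hW : W.Nonempty) (hZW : Disjoint Z W) :
      4 ≤ (cut G Z).card := by
    refine hG Z hZ fun hZ => hW.ne_empty ?_
    exact Finset.disjoint_self_iff_empty W |>.1 (hZW.mono_left (hZ ▸ W.subset_univ))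
  have opposite (Z W : Finset V) : Disjoint (X ∩ Z) (Xᶜ ∩ W) :=
    disjoint_compl_right.mono Finset.inter_subset_left Finset.inter_subset_left
  have cut₁ := four_le h₁ h₄ (opposite _ _)
  have cut₂ := four_le h₂ h₃ (opposite _ _)
  have cut₃ := four_le h₃ h₂ (opposite _ _).symm
  have cut₄ := four_le h₄ h₁ (opposite _ _).symm
  have cut_X := card_cut_eq (G := G) X Y
  have cut_Y := card_cut_eq (G := G) Y X
  have cut₁_eq := card_cut_inter (G := G) X Y
  have cut₂_eq := card_cut_inter (G := G) X Yᶜ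
  have cut₃_eq := card_cut_inter (G := G) Xᶜ Y
  have cut₄_eq := card_cut_inter (G := G) Xᶜ Yᶜ
  simp only [Finset.inter_comm Y, Finset.inter_comm Yᶜ, compl_compl,
    joinEdges_comm (X := X ∩ Yᶜ) (Y := X ∩ Y), joinEdges_comm (X := Xᶜ ∩ Y) (Y := X ∩ Y),
    joinEdges_comm (X := Xᶜ ∩ Yᶜ) (Y := X ∩ Y), joinEdges_comm (X := Xᶜ ∩ Yᶜ) (Y := X ∩ Yᶜ),
    joinEdges_comm (X := Xᶜ ∩ Yᶜ) (Y := Xᶜ ∩ Y), joinEdges_comm (X := Xᶜ ∩ Y) (Y := X ∩ Yᶜ)] at *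
  rw [← Finset.card_eq_zero]
  omega

end Cuts

section Contractions

variable {V : Type*} [DecidableEq V] {G : Finset (Edge V)} {P A B : Finset (Finset V)}
  {X Y : Finset V}

theorem mem_verts {v : V} : v ∈ verts A ↔ ∃ X ∈ A, v ∈ X :=
  Finset.mem_biUnion

theorem subset_verts (hX : X ∈ A) : X ⊆ verts A :=
  Finset.subset_biUnion_of_mem id hX

theorem verts_mono (h : A ⊆ B) : verts A ⊆ verts B :=
  Finset.biUnion_subset_biUnion_of_subset_left id h

theorem verts_singleton : verts {X} = X :=
  Finset.singleton_biUnion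

theorem verts_insert : verts (insert X A) = X ∪ verts A :=
  Finset.biUnion_insert

theorem Crosses.symm (h : Crosses P A B) : Crosses P B A :=
  ⟨h.2.1, h.1, Finset.inter_comm A B ▸ h.2.2.1, Finset.union_comm A B ▸ h.2.2.2⟩

theorem Crosses.sdiff_right (hA : A ⊆ P) (hB : B ⊆ P) (h : Crosses P A B) :
    Crosses P A (P \ B) := by
  obtain ⟨⟨X, hX⟩, ⟨Y, hY⟩, ⟨Z, hZ⟩, W, hW⟩ := h
  simp only [Finset.mem_sdiff, Finset.mem_inter, Finset.mem_union, not_or] at hX hY hZ hW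
  refine ⟨⟨Z, ?_⟩, ⟨W, ?_⟩, ⟨X, ?_⟩, ⟨Y, ?_⟩⟩
  · simp [hZ]
  · simp [hW]
  · simp [hX, hA hX.1]
  · simp [hY, hB hY.1]

theorem joinEdges_verts_right : joinEdges G X (verts A) = A.biUnion (joinEdges G X) := by
  ext e
  simp only [mem_joinEdges, Finset.mem_biUnion, Joins, mem_verts]
  tauto

theorem card_joinEdges_verts_right (hA : (A : Set (Finset V)).PairwiseDisjoint id)
    (hX : Disjoint X (verts A)) :
    (joinEdges G X (verts A)).card = ∑ Y ∈ A, (joinEdges G X Y).card := by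
  rw [joinEdges_verts_right, Finset.card_biUnion]
  exact fun Y hY Z hZ hYZ =>
    disjoint_joinEdges (hX.mono_right (subset_verts hY)) (hA hY hZ hYZ)

theorem card_joinEdges_verts_verts (hA : (A : Set (Finset V)).PairwiseDisjoint id)
    (hB : (B : Set (Finset V)).PairwiseDisjoint id) (hAB : Disjoint (verts A) (verts B)) :
    (joinEdges G (verts A) (verts B)).card = ∑ X ∈ A, ∑ Y ∈ B, (joinEdges G X Y).card := by
  rw [joinEdges_comm, card_joinEdges_verts_right hA hAB.symm]
  refine Finset.sum_congr rfl fun X hX => ?_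
  rw [joinEdges_comm, card_joinEdges_verts_right hB (hAB.mono_left (subset_verts hX))]

theorem IsProper.sdiff (h : IsProper P A) : IsProper P (P \ A) :=
  ⟨Finset.sdiff_subset, h.2.2, (Finset.sdiff_sdiff_eq_self h.1).symm ▸ h.2.1⟩

omit [DecidableEq V] in
theorem card_joinEdges_eq_sum (hXY : Disjoint X Y) :
    (joinEdges G X Y).card = ∑ u ∈ X, ∑ v ∈ Y, (joinEdges G {u} {v}).card := by
  classical
  have verts_image (Z : Finset V) : verts (Z.image singleton) = Z := by
    rw [verts, Finset.image_biUnion]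
    exact Finset.biUnion_singleton_eq_self
  have pairwiseDisjoint (Z : Finset V) :
      ((Z.image singleton : Finset (Finset V)) : Set (Finset V)).PairwiseDisjoint id := by
    rw [Finset.coe_image]
    exact Finset.pairwiseDisjoint_range_singleton.subset (Set.image_subset_range _ _)
  rw [← verts_image X, ← verts_image Y] at hXY ⊢
  rw [card_joinEdges_verts_verts (pairwiseDisjoint X) (pairwiseDisjoint Y) hXY]
  simp only [verts_image, Finset.sum_image Finset.singleton_injective.injOn]

theorem card_joinEdges_singleton (u v : V) :
    (joinEdges G {u} {v}).card = (Finset.univ.filter fun i => (s(u, v), i) ∈ G).card := by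
  have image_eq :
      (Finset.univ.filter fun i => (s(u, v), i) ∈ G).image (Prod.mk s(u, v)) =
        joinEdges G {u} {v} := by
    ext ⟨g, i⟩
    simp only [mem_joinEdges, Joins, Finset.mem_singleton, exists_eq_left, Finset.mem_image,
      Finset.mem_filter, Finset.mem_univ, true_and, Prod.mk.injEq]
    constructor
    · rintro ⟨i, hi, rfl, rfl⟩
      exact ⟨hi, rfl⟩
    · rintro ⟨hi, rfl⟩
      exact ⟨i, hi, rfl, rfl⟩
  rw [← image_eq, Finset.card_image_of_injective _ (Prod.mk_right_injective s(u, v))]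

variable [Fintype V]

/-- The sets in `P` are the nodes of a contraction of `G`: they partition `V`, and the contracted
graph is four-regular. -/
structure IsContraction (G : Finset (Edge V)) (P : Finset (Finset V)) : Prop where
  nonempty : ∀ X ∈ P, X.Nonempty
  pairwiseDisjoint : (P : Set (Finset V)).PairwiseDisjoint id
  verts_eq_univ : verts P = Finset.univ
  card_cut : ∀ X ∈ P, (cut G X).card = 4

namespace IsContraction

theorem pairwiseDisjoint_of_subset (hP : IsContraction G P) (hA : A ⊆ P) :
    (A : Set (Finset V)).PairwiseDisjoint id :=
  hP.pairwiseDisjoint.subset hA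

theorem eq_of_mem (hP : IsContraction G P) (hX : X ∈ P) (hY : Y ∈ P) {v : V} (hvX : v ∈ X)
    (hvY : v ∈ Y) : X = Y :=
  hP.pairwiseDisjoint.elim_finset hX hY v hvX hvY

theorem exists_mem (hP : IsContraction G P) (v : V) : ∃ X ∈ P, v ∈ X :=
  mem_verts.1 (hP.verts_eq_univ ▸ Finset.mem_univ v)

theorem verts_nonempty (hP : IsContraction G P) (hA : A ⊆ P) (hne : A.Nonempty) :
    (verts A).Nonempty := by
  obtain ⟨X, hX⟩ := hne
  exact (hP.nonempty X (hA hX)).mono (subset_verts hX)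

theorem verts_inter (hP : IsContraction G P) (hA : A ⊆ P) (hB : B ⊆ P) :
    verts (A ∩ B) = verts A ∩ verts B := by
  ext v
  simp only [Finset.mem_inter, mem_verts]
  constructor
  · rintro ⟨X, ⟨hXA, hXB⟩, hv⟩
    exact ⟨⟨X, hXA, hv⟩, X, hXB, hv⟩
  · rintro ⟨⟨X, hX, hvX⟩, Y, hY, hvY⟩
    obtain rfl := hP.eq_of_mem (hA hX) (hB hY) hvX hvY
    exact ⟨X, ⟨hX, hY⟩, hvX⟩

theorem verts_sdiff (hP : IsContraction G P) (hA : A ⊆ P) : verts (P \ A) = (verts A)ᶜ := by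
  refine eq_compl_iff_isCompl.2 <| IsCompl.of_eq ?_ ?_
  · rw [Finset.inf_eq_inter, ← hP.verts_inter Finset.sdiff_subset hA, Finset.sdiff_inter_self]
    rfl
  · rw [Finset.sup_eq_union, verts, verts, ← Finset.union_biUnion, Finset.sdiff_union_of_subset hA]
    exact hP.verts_eq_univ

theorem disjoint_verts (hP : IsContraction G P) (hA : A ⊆ P) (hX : X ∈ P) (hXA : X ∉ A) :
    Disjoint X (verts A) := by
  refine Finset.disjoint_left.2 fun v hvX hvA => ?_
  obtain ⟨Y, hY, hvY⟩ := mem_verts.1 hvA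
  exact hXA (hP.eq_of_mem hX (hA hY) hvX hvY ▸ hY)

theorem isTight_sdiff (hP : IsContraction G P) (hA : A ⊆ P) (h : IsTight G A) :
    IsTight G (P \ A) := by
  rwa [IsTight, hP.verts_sdiff hA, cut_compl]

theorem card_cut_eq_sum (hP : IsContraction G P) (hX : X ∈ P) (H : Finset (Edge V)) :
    (cut H X).card = ∑ Y ∈ P.erase X, (joinEdges H X Y).card := by
  rw [cut_eq_joinEdges, ← verts_singleton (X := X),
    ← hP.verts_sdiff (Finset.singleton_subset_iff.2 hX), Finset.sdiff_singleton_eq_erase,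
    verts_singleton, card_joinEdges_verts_right
      (hP.pairwiseDisjoint_of_subset (Finset.erase_subset X P))
      (hP.disjoint_verts (Finset.erase_subset X P) hX (Finset.notMem_erase X P))]

theorem sum_card_joinEdges (hP : IsContraction G P) (hX : X ∈ P) :
    ∑ Y ∈ P.erase X, (joinEdges G X Y).card = 4 := by
  rw [← hP.card_cut_eq_sum hX, hP.card_cut X hX]

theorem exists_joins (hP : IsContraction G P) (e : Edge V) : ∃ X ∈ P, ∃ Y ∈ P, Joins e X Y := by
  obtain ⟨⟨u, v⟩, i⟩ := e
  obtain ⟨X, hX, hu⟩ := hP.exists_mem u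
  obtain ⟨Y, hY, hv⟩ := hP.exists_mem v
  exact ⟨X, hX, Y, hY, u, hu, v, hv, rfl⟩

theorem eq_of_joins (hP : IsContraction G P) {e : Edge V} {X' Y' : Finset V} (hX : X ∈ P)
    (hY : Y ∈ P) (hX' : X' ∈ P) (hY' : Y' ∈ P) (h : Joins e X Y) (h' : Joins e X' Y') :
    X = X' ∧ Y = Y' ∨ X = Y' ∧ Y = X' := by
  obtain ⟨u, hu, v, hv, huv⟩ := h
  obtain ⟨u', hu', v', hv', huv'⟩ := h'
  obtain ⟨rfl, rfl⟩ | ⟨rfl, rfl⟩ := Sym2.eq_iff.1 (huv.symm.trans huv')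
  · exact .inl ⟨hP.eq_of_mem hX hX' hu hu', hP.eq_of_mem hY hY' hv hv'⟩
  · exact .inr ⟨hP.eq_of_mem hX hY' hu hv', hP.eq_of_mem hY hX' hv hu'⟩

theorem joinEdges_subset_cut (hP : IsContraction G P) (hX : X ∈ P) (hY : Y ∈ P) (hXY : X ≠ Y) :
    joinEdges G X Y ⊆ cut G X :=
  joinEdges_mono subset_rfl (le_compl_iff_disjoint_left.2 (hP.pairwiseDisjoint hX hY hXY))

theorem corners (hP : IsContraction G P) (hG : IsFourEdgeConnected G) (hA : A ⊆ P) (hB : B ⊆ P)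
    (hAt : IsTight G A) (hBt : IsTight G B) (h : Crosses P A B) :
    IsTight G (A ∩ B) ∧ (joinEdges G (verts (A ∩ B)) (verts (A \ B))).card = 2 ∧
      joinEdges G (verts (A \ B)) (verts (B \ A)) = ∅ := by
  have inter_sdiff {C D : Finset (Finset V)} (hC : C ⊆ P) : C ∩ (P \ D) = C \ D := by
    rw [← Finset.inter_sdiff_assoc, Finset.inter_eq_left.2 hC]
  have hA' : P \ A ⊆ P := Finset.sdiff_subset
  have hB' : P \ B ⊆ P := Finset.sdiff_subset
  obtain ⟨h₂, h₃, h₁, h₄⟩ := h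
  rw [← inter_sdiff hA] at h₂
  rw [← inter_sdiff hB, Finset.inter_comm] at h₃
  rw [Finset.sdiff_union_distrib] at h₄
  rw [← inter_sdiff hA, ← inter_sdiff hB, Finset.inter_comm B, hP.verts_inter hA hB,
    hP.verts_inter hA hB', hP.verts_inter hA' hB, hP.verts_sdiff hA, hP.verts_sdiff hB, IsTight,
    hP.verts_inter hA hB]
  have corner_nonempty {C D : Finset (Finset V)} (hC : C ⊆ P) (hD : D ⊆ P)
      (h : (C ∩ D).Nonempty) : (verts C ∩ verts D).Nonempty :=
    hP.verts_inter hC hD ▸ hP.verts_nonempty (Finset.inter_subset_left.trans hC) h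
  refine hG.corners hAt hBt (corner_nonempty hA hB h₁) ?_ ?_ ?_
  · exact hP.verts_sdiff hB ▸ corner_nonempty hA hB' h₂
  · exact hP.verts_sdiff hA ▸ corner_nonempty hA' hB h₃
  · exact hP.verts_sdiff hA ▸ hP.verts_sdiff hB ▸ corner_nonempty hA' hB' h₄

theorem exists_crosses_of_not_isUncrossed (hP : IsContraction G P) (hA : IsProper P A)
    (hAt : IsTight G A) (hu : ¬ IsUncrossed G P A) (hX : X ∈ P) :
    ∃ B ⊆ P, IsTight G B ∧ Crosses P A B ∧ X ∈ B := by
  obtain ⟨B, hB, hBt, hcross⟩ : ∃ B ⊆ P, IsTight G B ∧ Crosses P A B := by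
    by_contra! h
    exact hu ⟨hA, hAt, h⟩
  by_cases hXB : X ∈ B
  · exact ⟨B, hB, hBt, hcross, hXB⟩
  · exact ⟨P \ B, Finset.sdiff_subset, hP.isTight_sdiff hB hBt, hcross.sdiff_right hA.1 hB,
      Finset.mem_sdiff.2 ⟨hX, hXB⟩⟩

end IsContraction

end Contractions

section Doubled

variable {V : Type*} {G : Finset (Edge V)} {P A B : Finset (Finset V)} {X Y : Finset V}

/-- The contracted graph with node set `P` arises from a simple graph by doubling every edge. In a
four-regular graph this is the shape of a cycle cut: a cycle of doubled edges. -/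
def IsDoubled (G : Finset (Edge V)) (P : Finset (Finset V)) : Prop :=
  ∀ X ∈ P, ∀ Y ∈ P, X ≠ Y → (joinEdges G X Y).card = 0 ∨ (joinEdges G X Y).card = 2

theorem IsDoubled.mono (hd : IsDoubled G P) (h : B ⊆ P) : IsDoubled G B :=
  fun X hX Y hY => hd X (h hX) Y (h hY)

variable [Fintype V] [DecidableEq V]

namespace IsContraction

theorem isProper_of_card_joinEdges_eq_two (hP : IsContraction G P) (hA : A ⊆ P)
    (hcard : 2 ≤ A.card) (hX : X ∈ P) (hXA : X ∉ A) (h : (joinEdges G X (verts A)).card = 2) :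
    IsProper P A := by
  refine ⟨hA, hcard, ?_⟩
  have hXP : X ∈ P \ A := Finset.mem_sdiff.2 ⟨hX, hXA⟩
  by_contra! hlt
  have sdiff_eq : P \ A = {X} :=
    Finset.eq_singleton_iff_unique_mem.2 ⟨hXP, fun Y hY => Finset.card_le_one.1
      (Nat.le_of_lt_succ hlt) Y hY X hXP⟩
  have compl_eq : Xᶜ = verts A := by
    rw [compl_eq_comm, ← hP.verts_sdiff hA, sdiff_eq, verts_singleton]
  have := hP.card_cut X hX
  rw [cut_eq_joinEdges, compl_eq, h] at this
  omega

/-- Induction on `A`: if `B` is a tight set that crosses `A` and contains `X`, then no edge joins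
`X` to `A \ B`, so that `A ∩ B` is a smaller tight set with two edges to `X`. -/
theorem card_joinEdges_of_isTight (hP : IsContraction G P) (hG : IsFourEdgeConnected G)
    (hu : ∀ B, ¬ IsUncrossed G P B) (hA : A ⊆ P) (hAt : IsTight G A) (hX : X ∈ P) (hXA : X ∉ A)
    (h : (joinEdges G X (verts A)).card = 2) (hY : Y ∈ A) :
    (joinEdges G X Y).card = 0 ∨ (joinEdges G X Y).card = 2 := by
  induction A using Finset.strongInduction with
  | H A ih =>
    obtain hcard | hcard := Nat.lt_or_ge 1 A.card
    swap
    · right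
      rwa [Finset.eq_singleton_iff_unique_mem.2
        ⟨hY, fun Z hZ => Finset.card_le_one.1 hcard Z hZ Y hY⟩, verts_singleton] at h
    have hprop := hP.isProper_of_card_joinEdges_eq_two hA hcard hX hXA h
    obtain ⟨B, hB, hBt, hcross, hXB⟩ :=
      hP.exists_crosses_of_not_isUncrossed hprop hAt (hu A) hX
    obtain ⟨hABt, -, hopp⟩ := hP.corners hG hA hB hAt hBt hcross
    have joinEdges_sdiff : joinEdges G X (verts (A \ B)) = ∅ := by
      rw [← Finset.subset_empty, ← hopp, joinEdges_comm]
      exact joinEdges_mono subset_rfl (subset_verts (Finset.mem_sdiff.2 ⟨hXB, hXA⟩))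
    by_cases hYB : Y ∈ B
    · have joinEdges_inter : (joinEdges G X (verts (A ∩ B))).card = 2 := by
        rw [← h, joinEdges_verts_right (A := A), ← Finset.sdiff_union_inter A B,
          Finset.union_biUnion, ← joinEdges_verts_right, ← joinEdges_verts_right, joinEdges_sdiff,
          Finset.empty_union, Finset.sdiff_union_inter]
      have hne : A ∩ B ≠ A := fun heq => hcross.1.ne_empty <|
        Finset.sdiff_eq_empty_iff_subset.2 (Finset.inter_eq_left.1 heq)
      exact ih (A ∩ B) (Finset.inter_subset_left.ssubset_of_ne hne)
        (Finset.inter_subset_left.trans hA) hABt (fun hmem => hXA (Finset.mem_inter.1 hmem).1)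
        joinEdges_inter (Finset.mem_inter.2 ⟨hY, hYB⟩)
    · left
      rw [Finset.card_eq_zero, ← Finset.subset_empty, ← joinEdges_sdiff]
      exact joinEdges_mono subset_rfl (subset_verts (Finset.mem_sdiff.2 ⟨hY, hYB⟩))

theorem card_joinEdges_of_inter_eq (hP : IsContraction G P) (hG : IsFourEdgeConnected G)
    (hu : ∀ C, ¬ IsUncrossed G P C) (hA : A ⊆ P) (hB : B ⊆ P) (hAt : IsTight G A)
    (hBt : IsTight G B) (h : Crosses P A B) (hX : A ∩ B = {X}) (hY : Y ∈ A \ B) :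
    (joinEdges G X Y).card = 0 ∨ (joinEdges G X Y).card = 2 := by
  have hXAB : X ∈ A ∩ B := hX ▸ Finset.mem_singleton_self X
  have hXB := (Finset.mem_inter.1 hXAB).2
  obtain ⟨-, card_corner, -⟩ := hP.corners hG hA hB hAt hBt h
  rw [hX, verts_singleton] at card_corner
  have tight_corner : IsTight G (A \ B) := by
    have := (hP.corners hG hA Finset.sdiff_subset hAt (hP.isTight_sdiff hB hBt)
      (h.sdiff_right hA hB)).1
    rwa [← Finset.inter_sdiff_assoc, Finset.inter_eq_left.2 hA] at this
  exact hP.card_joinEdges_of_isTight hG hu (Finset.sdiff_subset.trans hA) tight_corner (hB hXB)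
    (fun hmem => (Finset.mem_sdiff.1 hmem).2 hXB) card_corner hY

theorem joinEdges_eq_empty_of_notMem_union (hP : IsContraction G P) (hG : IsFourEdgeConnected G)
    (hA : A ⊆ P) (hB : B ⊆ P) (hAt : IsTight G A) (hBt : IsTight G B) (h : Crosses P A B)
    (hX : X ∈ A ∩ B) (hY : Y ∈ P \ (A ∪ B)) : joinEdges G X Y = ∅ := by
  obtain ⟨-, -, opposite⟩ := hP.corners hG hA Finset.sdiff_subset hAt (hP.isTight_sdiff hB hBt)
    (h.sdiff_right hA hB)
  simp only [Finset.mem_inter, Finset.mem_sdiff, Finset.mem_union, not_or] at hX hY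
  rw [← Finset.subset_empty, ← opposite]
  refine joinEdges_mono (subset_verts ?_) (subset_verts ?_)
  · simp [hX]
  · simp [hY]

/-- Crossing `A` by tight sets that contain `X` shrinks it to `{X}`; in the last step the two
corners next to `{X}` are tight with two edges to `X` each. -/
theorem card_joinEdges_of_isProper (hP : IsContraction G P) (hG : IsFourEdgeConnected G)
    (hu : ∀ B, ¬ IsUncrossed G P B) (hA : IsProper P A) (hAt : IsTight G A) (hX : X ∈ A)
    (hY : Y ∈ P) (hXY : X ≠ Y) :
    (joinEdges G X Y).card = 0 ∨ (joinEdges G X Y).card = 2 := by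
  induction A using Finset.strongInduction with
  | H A ih =>
    have hXP := hA.1 hX
    obtain ⟨B, hB, hBt, hcross, hXB⟩ :=
      hP.exists_crosses_of_not_isUncrossed hA hAt (hu A) hXP
    obtain ⟨hABt, -, -⟩ := hP.corners hG hA.1 hB hAt hBt hcross
    obtain hcard | hcard := Nat.lt_or_ge 1 (A ∩ B).card
    · have hne : A ∩ B ≠ A := fun heq => hcross.1.ne_empty <|
        Finset.sdiff_eq_empty_iff_subset.2 (Finset.inter_eq_left.1 heq)
      have hABP : IsProper P (A ∩ B) := ⟨Finset.inter_subset_left.trans hA.1, hcard,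
        hA.2.2.trans (Finset.card_le_card (Finset.sdiff_subset_sdiff subset_rfl
          Finset.inter_subset_left))⟩
      exact ih _ (Finset.inter_subset_left.ssubset_of_ne hne) hABP hABt
        (Finset.mem_inter.2 ⟨hX, hXB⟩)
    have inter_eq : A ∩ B = {X} := Finset.eq_singleton_iff_unique_mem.2
      ⟨Finset.mem_inter.2 ⟨hX, hXB⟩, fun Z hZ => Finset.card_le_one.1 hcard Z hZ X
        (Finset.mem_inter.2 ⟨hX, hXB⟩)⟩
    by_cases hYA : Y ∈ A <;> by_cases hYB : Y ∈ B
    · exact absurd (Finset.mem_singleton.1 (inter_eq ▸ Finset.mem_inter.2 ⟨hYA, hYB⟩)) hXY.symm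
    · exact hP.card_joinEdges_of_inter_eq hG hu hA.1 hB hAt hBt hcross inter_eq
        (Finset.mem_sdiff.2 ⟨hYA, hYB⟩)
    · exact hP.card_joinEdges_of_inter_eq hG hu hB hA.1 hBt hAt hcross.symm
        (Finset.inter_comm A B ▸ inter_eq) (Finset.mem_sdiff.2 ⟨hYB, hYA⟩)
    · left
      rw [hP.joinEdges_eq_empty_of_notMem_union hG hA.1 hB hAt hBt hcross
        (Finset.mem_inter.2 ⟨hX, hXB⟩) (by simp [hY, hYA, hYB]), Finset.card_empty]

theorem card_joinEdges_of_card_eq_three (hP : IsContraction G P) (hcard : P.card = 3)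
    (hX : X ∈ P) (hY : Y ∈ P) (hXY : X ≠ Y) : (joinEdges G X Y).card = 2 := by
  obtain ⟨Z, hZ⟩ : ∃ Z, (P.erase X).erase Y = {Z} := by
    rw [← Finset.card_eq_one, Finset.card_erase_of_mem (by simp [hY, hXY.symm]),
      Finset.card_erase_of_mem hX, hcard]
  have mem_iff (W : Finset V) : W ≠ Y ∧ W ≠ X ∧ W ∈ P ↔ W = Z := by
    rw [← Finset.mem_erase, ← Finset.mem_erase, hZ, Finset.mem_singleton]
  obtain ⟨hZY, hZX, hZP⟩ := (mem_iff Z).2 rfl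
  have erase_eq {U W W' : Finset V} (h : ∀ T, T ∈ P ∧ T ≠ U ↔ T = W ∨ T = W') :
      P.erase U = {W, W'} := by
    ext T
    simp [← h, and_comm]
  have sum_X := hP.sum_card_joinEdges hX
  have sum_Y := hP.sum_card_joinEdges hY
  have sum_Z := hP.sum_card_joinEdges hZP
  rw [erase_eq (W := Y) (W' := Z) (by grind), Finset.sum_pair hZY.symm] at sum_X
  rw [erase_eq (W := X) (W' := Z) (by grind), Finset.sum_pair hZX.symm, joinEdges_comm] at sum_Y
  rw [erase_eq (W := X) (W' := Y) (by grind), Finset.sum_pair hXY, joinEdges_comm,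
    joinEdges_comm (X := Z)] at sum_Z
  omega

theorem isDoubled_of_card_eq_three (hP : IsContraction G P) (hcard : P.card = 3) :
    IsDoubled G P := fun _ hX _ hY hXY =>
  .inr (hP.card_joinEdges_of_card_eq_three hcard hX hY hXY)

theorem isDoubled_of_forall_not_isUncrossed (hP : IsContraction G P) (hG : IsFourEdgeConnected G)
    (hu : ∀ B, ¬ IsUncrossed G P B) (hA : IsProper P A) (hAt : IsTight G A) :
    IsDoubled G P := by
  intro X hX Y hY hXY
  by_cases hXA : X ∈ A
  · exact hP.card_joinEdges_of_isProper hG hu hA hAt hXA hY hXY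
  · exact hP.card_joinEdges_of_isProper hG hu hA.sdiff (hP.isTight_sdiff hA.1 hAt)
      (Finset.mem_sdiff.2 ⟨hX, hXA⟩) hY hXY

end IsContraction

end Doubled

section ContractedComplement

variable {V : Type*} [Fintype V] [DecidableEq V] {G : Finset (Edge V)} {f : Sym2 V}
  {P S A B : Finset (Finset V)}

/-- The node set of the graph in which everything outside the set `S` of nodes is contracted to a
single node. -/
def contractCompl (S : Finset (Finset V)) : Finset (Finset V) :=
  insert (verts S)ᶜ S

theorem subset_contractCompl : S ⊆ contractCompl S :=
  Finset.subset_insert _ _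

theorem compl_verts_mem_contractCompl : (verts S)ᶜ ∈ contractCompl S :=
  Finset.mem_insert_self _ _

theorem IsUncrossed.sdiff_nonempty (h : IsUncrossed G P S) : (P \ S).Nonempty :=
  Finset.card_pos.1 (Nat.lt_of_lt_of_le two_pos h.1.2.2)

namespace IsContraction

theorem compl_verts_notMem (hP : IsContraction G P) (hS : S ⊆ P) : (verts S)ᶜ ∉ S := by
  intro hmem
  have empty : (verts S)ᶜ = ∅ :=
    Finset.disjoint_self_iff_empty _ |>.1 (disjoint_compl_left.mono_right (subset_verts hmem))
  exact (hP.nonempty _ (hS hmem)).ne_empty empty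

theorem isUncrossed_sdiff (hP : IsContraction G P) (h : IsUncrossed G P A) :
    IsUncrossed G P (P \ A) := by
  refine ⟨h.1.sdiff, hP.isTight_sdiff h.1.1 h.2.1, fun B hB hBt hcross => h.2.2 B hB hBt ?_⟩
  have := hcross.symm.sdiff_right hB Finset.sdiff_subset
  rw [Finset.sdiff_sdiff_eq_self h.1.1] at this
  exact this.symm

theorem isContraction_contractCompl (hP : IsContraction G P) (hS : IsUncrossed G P S) :
    IsContraction G (contractCompl S) where
  nonempty := by
    refine Finset.forall_mem_insert _ _ _ |>.2 ⟨?_, fun X hX => hP.nonempty X (hS.1.1 hX)⟩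
    exact hP.verts_sdiff hS.1.1 ▸ hP.verts_nonempty Finset.sdiff_subset hS.sdiff_nonempty
  pairwiseDisjoint := by
    rw [contractCompl, Finset.coe_insert]
    exact (hP.pairwiseDisjoint_of_subset hS.1.1).insert fun X hX _ =>
      disjoint_compl_left.mono_right (subset_verts hX)
  verts_eq_univ := by
    rw [contractCompl, verts_insert, Finset.union_comm, Finset.union_compl]
  card_cut := by
    refine Finset.forall_mem_insert _ _ _ |>.2 ⟨?_, fun X hX => hP.card_cut X (hS.1.1 hX)⟩
    rw [cut_compl]
    exact hS.2.1

theorem exists_subset_of_crosses (hP : IsContraction G P) (hS : IsUncrossed G P S) (hA : A ⊆ S)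
    (hB : B ⊆ P) (hBt : IsTight G B) (h : Crosses P A B) :
    ∃ C ⊆ S, IsTight G C ∧ Crosses P A C := by
  have hSB : (S \ B).Nonempty := h.1.mono (Finset.sdiff_subset_sdiff hA subset_rfl)
  have hSB' : (S ∩ B).Nonempty := h.2.2.1.mono (Finset.inter_subset_inter_right hA)
  by_cases hBS : B ⊆ S
  · exact ⟨B, hBS, hBt, h⟩
  by_cases hcover : P ⊆ S ∪ B
  · exact ⟨P \ B, sdiff_le_iff'.2 hcover, hP.isTight_sdiff hB hBt,
      h.sdiff_right (hA.trans hS.1.1) hB⟩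
  · exact absurd ⟨hSB, Finset.sdiff_nonempty.2 hBS, hSB', Finset.sdiff_nonempty.2 hcover⟩
      (hS.2.2 B hB hBt)

theorem isUncrossed_of_contractCompl (hP : IsContraction G P) (hS : IsUncrossed G P S)
    (hA : A ⊆ S) (h : IsUncrossed G (contractCompl S) A) :
    IsUncrossed G P A := by
  refine ⟨⟨hA.trans hS.1.1, h.1.2.1, hS.1.2.2.trans
    (Finset.card_le_card (Finset.sdiff_subset_sdiff subset_rfl hA))⟩, h.2.1, ?_⟩
  intro B hB hBt hcross
  obtain ⟨C, hC, hCt, hAC⟩ := hP.exists_subset_of_crosses hS hA hB hBt hcross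
  refine h.2.2 C (hC.trans subset_contractCompl) hCt ⟨hAC.1, hAC.2.1, hAC.2.2.1, _,
    Finset.mem_sdiff.2 ⟨compl_verts_mem_contractCompl, fun hmem => ?_⟩⟩
  exact hP.compl_verts_notMem hS.1.1 (Finset.union_subset hA hC hmem)

theorem isCandidate_of_contractCompl (hP : IsContraction G P) (hS : IsCandidate G f P S)
    (hA : IsUncrossed G (contractCompl S) A) (hmem : (verts S)ᶜ ∉ A) :
    A ⊂ S ∧ IsCandidate G f P A := by
  have hAS : A ⊆ S := (Finset.subset_insert_iff_of_notMem hmem).1 hA.1.1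
  refine ⟨hAS.ssubset_of_ne ?_, hP.isUncrossed_of_contractCompl hS.1 hAS hA,
    fun h => hS.2 fun v hv => verts_mono hAS (h v hv)⟩
  rintro rfl
  have := hA.1.2.2
  rw [contractCompl,
    Finset.insert_sdiff_of_notMem _ (hP.compl_verts_notMem hS.1.1.1), Finset.sdiff_self,
    insert_empty_eq, Finset.card_singleton] at this
  omega

theorem forall_not_isUncrossed_contractCompl (hP : IsContraction G P)
    (hS : IsCandidate G f P S) (hmin : ∀ B ⊂ S, ¬ IsCandidate G f P B) (A : Finset (Finset V)) :
    ¬ IsUncrossed G (contractCompl S) A := by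
  intro hA
  by_cases hmem : (verts S)ᶜ ∈ A
  · obtain ⟨hlt, hcand⟩ := hP.isCandidate_of_contractCompl hS
      ((hP.isContraction_contractCompl hS.1).isUncrossed_sdiff hA)
      fun h => (Finset.mem_sdiff.1 h).2 hmem
    exact hmin _ hlt hcand
  · obtain ⟨hlt, hcand⟩ := hP.isCandidate_of_contractCompl hS hA hmem
    exact hmin _ hlt hcand

theorem isDoubled_contractCompl (hP : IsContraction G P) (hG : IsFourEdgeConnected G)
    (hS : IsCandidate G f P S) (hmin : ∀ B ⊂ S, ¬ IsCandidate G f P B)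
    (hcycle : S.card = 2 ∨ ∃ B ⊂ S, 2 ≤ B.card ∧ IsTight G B) :
    IsDoubled G (contractCompl S) := by
  have hO := hP.compl_verts_notMem hS.1.1.1
  obtain hcard | ⟨B, hBS, hcard, hBt⟩ := hcycle
  · exact (hP.isContraction_contractCompl hS.1).isDoubled_of_card_eq_three
      (by rw [contractCompl, Finset.card_insert_of_notMem hO, hcard])
  · refine (hP.isContraction_contractCompl hS.1).isDoubled_of_forall_not_isUncrossed hG
      (hP.forall_not_isUncrossed_contractCompl hS hmin)
      ⟨hBS.subset.trans subset_contractCompl, hcard, ?_⟩ hBt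
    have sdiff_pos := Finset.card_pos.2 (Finset.sdiff_nonempty.2 hBS.not_subset)
    rw [contractCompl,
      Finset.insert_sdiff_of_notMem _ fun h => hO (hBS.subset h),
      Finset.card_insert_of_notMem fun h => hO (Finset.mem_sdiff.1 h).1]
    omega

end IsContraction

end ContractedComplement

section RemainingGraph

variable {V : Type*} [Fintype V] [DecidableEq V] {G : Finset (Edge V)} {f : Sym2 V}
  {P : Finset (Finset V)} {X Y : Finset V}

namespace IsContraction

theorem isTight_pair (hP : IsContraction G P) (hG : IsFourEdgeConnected G) (hcard : 3 ≤ P.card)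
    (hX : X ∈ P) (hY : Y ∈ P) (hXY : X ≠ Y) (h : 2 ≤ (joinEdges G X Y).card) :
    IsTight G {X, Y} := by
  have pair_subset : {X, Y} ⊆ P := Finset.insert_subset hX (Finset.singleton_subset_iff.2 hY)
  have verts_ne_univ : verts {X, Y} ≠ Finset.univ := by
    rw [Ne, ← Finset.compl_eq_empty_iff, ← hP.verts_sdiff pair_subset]
    refine (hP.verts_nonempty Finset.sdiff_subset (Finset.card_pos.1 ?_)).ne_empty
    rw [Finset.card_sdiff_of_subset pair_subset, Finset.card_pair hXY]
    omega
  have four_le := hG _ (hP.verts_nonempty pair_subset (Finset.insert_nonempty X {Y})) verts_ne_univ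
  have card_union := card_cut_union (G := G) (hP.pairwiseDisjoint hX hY hXY)
  rw [id, id, hP.card_cut X hX, hP.card_cut Y hY] at card_union
  rw [verts_insert, verts_singleton] at four_le
  rw [IsTight, verts_insert, verts_singleton]
  omega

theorem isDoubled_of_two_le_card_joinEdges (hP : IsContraction G P) (hG : IsFourEdgeConnected G)
    (hu : ∀ B, ¬ IsUncrossed G P B) (hcard : 3 ≤ P.card) (hX : X ∈ P) (hY : Y ∈ P) (hXY : X ≠ Y)
    (h : 2 ≤ (joinEdges G X Y).card) : IsDoubled G P := by
  obtain hcard' | hcard' := hcard.eq_or_lt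
  · exact hP.isDoubled_of_card_eq_three hcard'.symm
  · have pair_subset : {X, Y} ⊆ P := Finset.insert_subset hX (Finset.singleton_subset_iff.2 hY)
    refine hP.isDoubled_of_forall_not_isUncrossed hG hu ⟨pair_subset, (Finset.card_pair hXY).ge, ?_⟩
      (hP.isTight_pair hG hcard hX hY hXY h)
    rw [Finset.card_sdiff_of_subset pair_subset, Finset.card_pair hXY]
    omega

theorem exists_pair_subset_joinEdges (hP : IsContraction G P) (hf : ∀ i, (f, i) ∈ G)
    (hfP : ∀ X ∈ P, ¬ ∀ v ∈ f, v ∈ X) :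
    ∃ X ∈ P, ∃ Y ∈ P, X ≠ Y ∧ {(f, 0), (f, 1)} ⊆ joinEdges G X Y := by
  obtain ⟨X, hX, Y, hY, u, hu, v, hv, rfl : f = s(u, v)⟩ := hP.exists_joins (f, 0)
  refine ⟨X, hX, Y, hY, ?_, Finset.insert_subset ?_ (Finset.singleton_subset_iff.2 ?_)⟩
  · rintro rfl
    exact hfP X hX (Sym2.forall_mem_pair.2 ⟨hu, hv⟩)
  all_goals exact mem_joinEdges.2 ⟨hf _, u, hu, v, hv, rfl⟩

theorem isDoubled_of_doubled_pair (hP : IsContraction G P) (hG : IsFourEdgeConnected G)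
    (hu : ∀ B, ¬ IsUncrossed G P B) (hcard : 3 ≤ P.card) (hf : ∀ i, (f, i) ∈ G)
    (hfP : ∀ X ∈ P, ¬ ∀ v ∈ f, v ∈ X) : IsDoubled G P := by
  obtain ⟨X, hX, Y, hY, hXY, hsub⟩ := hP.exists_pair_subset_joinEdges hf hfP
  exact hP.isDoubled_of_two_le_card_joinEdges hG hu hcard hX hY hXY
    (Finset.card_le_card hsub |>.trans' (by simp))

end IsContraction

end RemainingGraph

section Tours

variable {V : Type*} [DecidableEq V] {G T : Finset (Edge V)} {P B : Finset (Finset V)}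
  {f : Sym2 V} {X Y : Finset V}

/-- The set `T` of edges contains exactly half of the edges between any two nodes. A tour of a cycle
of doubled edges has this property, since it runs along one edge of each parallel pair. -/
def HalvesJoins (G : Finset (Edge V)) (P : Finset (Finset V)) (T : Finset (Edge V)) : Prop :=
  ∀ X ∈ P, ∀ Y ∈ P, X ≠ Y → 2 * (T ∩ joinEdges G X Y).card = (joinEdges G X Y).card

/-- The classes of parallel edges of the contracted graph with node set `P`. -/
noncomputable def joinClasses (G : Finset (Edge V)) (P : Finset (Finset V)) :
    Finset (Finset (Edge V)) :=
  (P.offDiag.image fun p => joinEdges G p.1 p.2).erase ∅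

theorem mem_joinClasses {D : Finset (Edge V)} : D ∈ joinClasses G P ↔
    D ≠ ∅ ∧ ∃ X ∈ P, ∃ Y ∈ P, X ≠ Y ∧ joinEdges G X Y = D := by
  simp only [joinClasses, Finset.mem_erase, Finset.mem_image, Finset.mem_offDiag, Prod.exists]
  tauto

theorem biUnion_joinClasses : (joinClasses G P).biUnion id = innerEdges G P := by
  ext e
  simp only [Finset.mem_biUnion, id, mem_innerEdges]
  constructor
  · rintro ⟨D, hD, he⟩
    obtain ⟨-, X, hX, Y, hY, hXY, rfl⟩ := mem_joinClasses.1 hD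
    obtain ⟨heG, heXY⟩ := mem_joinEdges.1 he
    exact ⟨heG, X, hX, Y, hY, hXY, heXY⟩
  · rintro ⟨heG, X, hX, Y, hY, hXY, heXY⟩
    have he : e ∈ joinEdges G X Y := mem_joinEdges.2 ⟨heG, heXY⟩
    exact ⟨_, mem_joinClasses.2 ⟨Finset.ne_empty_of_mem he, X, hX, Y, hY, hXY, rfl⟩, he⟩

theorem IsDoubled.card_eq_two (hd : IsDoubled G P) {D : Finset (Edge V)}
    (hD : D ∈ joinClasses G P) : D.card = 2 := by
  obtain ⟨hne, X, hX, Y, hY, hXY, rfl⟩ := mem_joinClasses.1 hD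
  exact (hd X hX Y hY hXY).resolve_left (Finset.card_ne_zero.2 (Finset.nonempty_iff_ne_empty.2 hne))

theorem IsDoubled.halvesJoins_iff (hd : IsDoubled G P) :
    HalvesJoins G P T ↔ ∀ D ∈ joinClasses G P, (T ∩ D).card = 1 := by
  constructor
  · intro h D hD
    obtain ⟨-, X, hX, Y, hY, hXY, rfl⟩ := mem_joinClasses.1 hD
    have := h X hX Y hY hXY
    rw [hd.card_eq_two hD] at this
    omega
  · intro h X hX Y hY hXY
    obtain hempty | hne := (joinEdges G X Y).eq_empty_or_nonempty
    · rw [hempty, Finset.inter_empty, Finset.card_empty]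
    · have hD := mem_joinClasses.2 ⟨hne.ne_empty, X, hX, Y, hY, hXY, rfl⟩
      rw [h _ hD, hd.card_eq_two hD]

theorem HalvesJoins.insert (hT : HalvesJoins G P T)
    (h : ∀ Y ∈ P, 2 * (T ∩ joinEdges G X Y).card = (joinEdges G X Y).card) :
    HalvesJoins G (insert X P) T := by
  intro Y hY Z hZ hYZ
  obtain rfl | hYP := Finset.mem_insert.1 hY
  · exact h Z ((Finset.mem_insert.1 hZ).resolve_left hYZ.symm)
  · obtain rfl | hZP := Finset.mem_insert.1 hZ
    · rw [joinEdges_comm]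
      exact h Y hYP
    · exact hT Y hYP Z hZP hYZ

theorem halvesJoins_inter_innerEdges :
    HalvesJoins G P (T ∩ innerEdges G P) ↔ HalvesJoins G P T := by
  refine forall₂_congr fun X hX => forall₂_congr fun Y hY => forall_congr' fun hXY => ?_
  have joinEdges_subset : joinEdges G X Y ⊆ innerEdges G P := fun e he =>
    mem_innerEdges.2 ⟨(mem_joinEdges.1 he).1, X, hX, Y, hY, hXY, (mem_joinEdges.1 he).2⟩
  rw [Finset.inter_assoc, Finset.inter_eq_right.2 joinEdges_subset]

variable [Fintype V]

theorem HalvesJoins.two_mul_card_inter_cut (h : HalvesJoins G P T) (hP : IsContraction G P)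
    (hB : B ⊆ P) : 2 * (T ∩ cut G (verts B)).card = (cut G (verts B)).card := by
  have disjoint : Disjoint (verts B) (verts (P \ B)) := hP.verts_sdiff hB ▸ disjoint_compl_right
  have card_eq (H : Finset (Edge V)) :
      (cut H (verts B)).card = ∑ X ∈ B, ∑ Y ∈ P \ B, (joinEdges H X Y).card := by
    rw [cut_eq_joinEdges, ← hP.verts_sdiff hB, card_joinEdges_verts_verts
      (hP.pairwiseDisjoint_of_subset hB) (hP.pairwiseDisjoint_of_subset Finset.sdiff_subset)
      disjoint]
  rw [inter_cut, card_eq, card_eq, Finset.mul_sum]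
  refine Finset.sum_congr rfl fun X hX => ?_
  rw [Finset.mul_sum]
  refine Finset.sum_congr rfl fun Y hY => ?_
  obtain ⟨hYP, hYB⟩ := Finset.mem_sdiff.1 hY
  rw [← inter_joinEdges, h X (hB hX) Y hYP (ne_of_mem_of_not_mem hX hYB)]

theorem HalvesJoins.card_inter_cut (h : HalvesJoins G P T) (hP : IsContraction G P) (hB : B ⊆ P)
    (hBt : IsTight G B) : (T ∩ cut G (verts B)).card = 2 := by
  have := h.two_mul_card_inter_cut hP hB
  rw [hBt] at this
  omega

namespace IsContraction

theorem pairwiseDisjoint_joinClasses (hP : IsContraction G P) :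
    (joinClasses G P : Set (Finset (Edge V))).PairwiseDisjoint id := by
  intro D hD D' hD' hne
  obtain ⟨-, X, hX, Y, hY, -, rfl⟩ := mem_joinClasses.1 hD
  obtain ⟨-, X', hX', Y', hY', -, rfl⟩ := mem_joinClasses.1 hD'
  refine Finset.disjoint_left.2 fun e he he' => hne ?_
  obtain ⟨rfl, rfl⟩ | ⟨rfl, rfl⟩ :=
    hP.eq_of_joins hX hY hX' hY' (mem_joinEdges.1 he).2 (mem_joinEdges.1 he').2
  exacts [rfl, joinEdges_comm]

/-- A tour that contains both edges of a parallel pair has degree two at its end nodes already, and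
cannot reach a third node. -/
theorem card_inter_joinEdges_le_one (hP : IsContraction G P) (hcard : 3 ≤ P.card)
    (hT : IsTour G f P T) (hX : X ∈ P) (hY : Y ∈ P) (hXY : X ≠ Y) :
    (T ∩ joinEdges G X Y).card ≤ 1 := by
  by_contra! hlt
  have cut_subset {Z W : Finset V} (hZ : Z ∈ P) (hW : W ∈ P) (hZW : Z ≠ W)
      (h : 1 < (T ∩ joinEdges G Z W).card) : T ∩ cut G Z ⊆ joinEdges G Z W := by
    rw [← Finset.eq_of_subset_of_card_le (Finset.inter_subset_inter_left
      (hP.joinEdges_subset_cut hZ hW hZW)) ((hT.2.2.1 Z hZ).trans_le h)]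
    exact Finset.inter_subset_right
  have sdiff_nonempty : (P \ {X, Y}).Nonempty := by
    rw [← Finset.card_pos]
    have := Finset.le_card_sdiff {X, Y} P
    rw [Finset.card_pair hXY] at this
    omega
  obtain ⟨e, he, Z, hZ, W, hW, heZW⟩ := connects_iff.1 hT.2.1 {X, Y}
    (Finset.insert_subset hX (Finset.singleton_subset_iff.2 hY)) (Finset.insert_nonempty _ _)
    sdiff_nonempty
  simp only [Finset.mem_insert, Finset.mem_singleton, Finset.mem_sdiff, not_or] at hZ hW
  obtain ⟨hWP, hWX, hWY⟩ := hW
  have heG := (mem_innerEdges.1 (hT.1 he)).1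
  have mem_cut {U : Finset V} (hU : U ∈ P) (hWU : W ≠ U) (h : Joins e U W) : e ∈ T ∩ cut G U :=
    Finset.mem_inter.2 ⟨he, hP.joinEdges_subset_cut hU hWP hWU.symm (mem_joinEdges.2 ⟨heG, h⟩)⟩
  obtain rfl | rfl := hZ
  · have := (mem_joinEdges.1 (cut_subset hX hY hXY hlt (mem_cut hX hWX heZW))).2
    obtain ⟨-, rfl⟩ | ⟨-, rfl⟩ := hP.eq_of_joins hX hWP hX hY heZW this
    exacts [hWY rfl, hWX rfl]
  · rw [joinEdges_comm] at hlt
    have := (mem_joinEdges.1 (cut_subset hY hX hXY.symm hlt (mem_cut hY hWY heZW))).2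
    obtain ⟨-, rfl⟩ | ⟨-, rfl⟩ := hP.eq_of_joins hY hWP hY hX heZW this
    exacts [hWX rfl, hWY rfl]

theorem halvesJoins_of_isTour (hP : IsContraction G P) (hd : IsDoubled G P) (hcard : 3 ≤ P.card)
    (hT : IsTour G f P T) : HalvesJoins G P T := by
  intro X hX Y hY hXY
  have two_mul_le : ∀ Z ∈ P.erase X, 2 * (T ∩ joinEdges G X Z).card ≤ (joinEdges G X Z).card := by
    intro Z hZ
    obtain ⟨hZX, hZP⟩ := Finset.mem_erase.1 hZ
    have le_one := hP.card_inter_joinEdges_le_one hcard hT hX hZP hZX.symm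
    have le_card := Finset.card_le_card
      (Finset.inter_subset_right (s₁ := T) (s₂ := joinEdges G X Z))
    have := hd X hX Z hZP hZX.symm
    omega
  refine (Finset.sum_eq_sum_iff_of_le two_mul_le).1 ?_ Y (Finset.mem_erase.2 ⟨hXY.symm, hY⟩)
  simp only [← Finset.mul_sum, inter_joinEdges]
  rw [← hP.card_cut_eq_sum hX, ← inter_cut, hT.2.2.1 X hX, hP.sum_card_joinEdges hX, two_mul]

theorem connects_of_halvesJoins (hP : IsContraction G P) (hG : IsFourEdgeConnected G)
    (hd : IsDoubled G P) (hT : HalvesJoins G P T) : Connects T P := by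
  refine connects_iff.2 fun C hC hne hne' => ?_
  have verts_ne_univ : verts C ≠ Finset.univ := by
    rw [Ne, ← Finset.compl_eq_empty_iff, ← hP.verts_sdiff hC]
    exact (hP.verts_nonempty Finset.sdiff_subset hne').ne_empty
  obtain ⟨e, he⟩ := Finset.card_pos.1 <|
    four_pos.trans_le (hG _ (hP.verts_nonempty hC hne) verts_ne_univ)
  rw [cut_eq_joinEdges, ← hP.verts_sdiff hC, joinEdges_verts_right, Finset.mem_biUnion] at he
  obtain ⟨Y, hY, he⟩ := he
  rw [joinEdges_comm, joinEdges_verts_right, Finset.mem_biUnion] at he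
  obtain ⟨X, hX, he⟩ := he
  have hYX : Y ≠ X := fun h => (Finset.mem_sdiff.1 hY).2 (h ▸ hX)
  obtain ⟨e', he'⟩ := Finset.card_pos.1 <| Nat.one_pos.trans_eq
    (hd.halvesJoins_iff.1 hT _ (mem_joinClasses.2 ⟨Finset.ne_empty_of_mem he, Y,
      (Finset.mem_sdiff.1 hY).1, X, hC hX, hYX, rfl⟩)).symm
  obtain ⟨heT, he'⟩ := Finset.mem_inter.1 he'
  exact ⟨e', heT, X, hX, Y, hY, (mem_joinEdges.1 he').2.symm⟩

theorem isTour_iff_mem_transversals (hP : IsContraction G P) (hG : IsFourEdgeConnected G)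
    (hd : IsDoubled G P) (hcard : 3 ≤ P.card) (hf : ∀ i, (f, i) ∈ G)
    (hfP : ∀ X ∈ P, ¬ ∀ v ∈ f, v ∈ X) : IsTour G f P T ↔ T ∈ transversals (joinClasses G P) := by
  rw [mem_transversals, biUnion_joinClasses, ← hd.halvesJoins_iff]
  refine ⟨fun hT => ⟨hT.1, hP.halvesJoins_of_isTour hd hcard hT⟩, fun ⟨hsub, hT⟩ =>
    ⟨hsub, hP.connects_of_halvesJoins hG hd hT, fun X hX => ?_, ?_⟩⟩
  · have := hT.card_inter_cut hP (Finset.singleton_subset_iff.2 hX)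
    rw [IsTight, verts_singleton] at this
    exact this (hP.card_cut X hX)
  · obtain ⟨X, hX, Y, hY, hXY, pair_subset⟩ := hP.exists_pair_subset_joinEdges hf hfP
    have hD := mem_joinClasses.2 ⟨Finset.ne_empty_of_mem (pair_subset (Finset.mem_insert_self _ _)),
      X, hX, Y, hY, hXY, rfl⟩
    have pair_eq := Finset.eq_of_subset_of_card_le pair_subset
      ((hd.card_eq_two hD).trans_le (by simp))
    obtain ⟨e, he⟩ := Finset.card_pos.1 <|
      Nat.one_pos.trans_eq (hd.halvesJoins_iff.1 hT _ hD).symm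
    rw [← pair_eq, Finset.mem_inter, Finset.mem_insert, Finset.mem_singleton] at he
    obtain ⟨heT, rfl | rfl⟩ := he
    exacts [⟨_, heT, rfl⟩, ⟨_, heT, rfl⟩]

theorem tourLaw_eq_productLaw (hP : IsContraction G P) (hG : IsFourEdgeConnected G)
    (hd : IsDoubled G P) (hcard : 3 ≤ P.card) (hf : ∀ i, (f, i) ∈ G)
    (hfP : ∀ X ∈ P, ¬ ∀ v ∈ f, v ∈ X) :
    tourLaw G f P = productLaw (transversals (joinClasses G P)) 1 := by
  classical
  have isTour_iff (T : Finset (Edge V)) :=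
    hP.isTour_iff_mem_transversals (T := T) hG hd hcard hf hfP
  ext T
  simp only [tourLaw, productLaw, isTour_iff, Finset.filter_univ_mem, Pi.one_apply,
    Finset.prod_const_one, Finset.sum_const, nsmul_eq_mul, mul_one]

theorem exists_isDeterminantal_tourLaw (hP : IsContraction G P) (hG : IsFourEdgeConnected G)
    (hd : IsDoubled G P) (hcard : 3 ≤ P.card) (hf : ∀ i, (f, i) ∈ G)
    (hfP : ∀ X ∈ P, ¬ ∀ v ∈ f, v ∈ X) : ∃ K, IsDeterminantal (tourLaw G f P) (innerEdges G P) K ∧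
      ∀ e ∈ innerEdges G P, K e e = 1 / 2 := by
  obtain ⟨K, hK, hdiag⟩ := exists_isDeterminantal_transversals hP.pairwiseDisjoint_joinClasses
    (Finset.notMem_erase ∅ _)
  rw [biUnion_joinClasses] at hK
  refine ⟨K, ?_, fun e he => ?_⟩
  · rwa [hP.tourLaw_eq_productLaw hG hd hcard hf hfP]
  · rw [← biUnion_joinClasses] at he
    obtain ⟨D, hD, he⟩ := Finset.mem_biUnion.1 he
    rw [hdiag D hD e he, hd.card_eq_two hD]
    norm_num

end IsContraction

end Tours

section CycleCuts

variable {V : Type*} [Fintype V] [DecidableEq V] {G T : Finset (Edge V)}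
  {P S : Finset (Finset V)} {X O : Finset V}

theorem IsMaxEntropy.halvesJoins {p : Finset (Edge V) → ℝ} (hp : IsMaxEntropy G S p)
    (hS : (S : Set (Finset V)).PairwiseDisjoint id) (hne : S.Nonempty) (hd : IsDoubled G S)
    (hT : p T ≠ 0) : HalvesJoins G S T := by
  obtain ⟨K, hK, hdiag⟩ := hp.exists_isDeterminantal hS hne
  refine hd.halvesJoins_iff.2 fun D hD => ?_
  have hcard := hd.card_eq_two hD
  have D_subset : D ⊆ innerEdges G S :=
    biUnion_joinClasses (G := G) ▸ Finset.subset_biUnion_of_mem id hD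
  obtain ⟨-, X, hX, Y, hY, -, rfl⟩ := mem_joinClasses.1 hD
  refine hK.card_inter_eq_of_le (m := 1) ?_ (fun T hT => ?_) hT
  · rw [Finset.sum_congr rfl fun e he => hdiag e (D_subset he), Finset.sum_const, hcard]
    norm_num
  · have hT : IsSpanningTree G S T := by
      by_contra h
      obtain ⟨⟨_, _, _, hpT⟩, -⟩ := hp
      exact hT ((hpT T).trans (if_neg h))
    have T_subset : T ⊆ G := hT.1.trans fun e he => (mem_innerEdges.1 he).1
    rw [inter_joinEdges, Finset.inter_eq_left.2 T_subset]
    exact hT.card_joinEdges_le_one hS hX hY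

theorem IsDoubled.exists_neighbors (hd : IsDoubled G P) (hP : IsContraction G P) (hO : O ∈ P) :
    ∃ X ∈ P.erase O, ∃ Y ∈ P.erase O, X ≠ Y ∧ (joinEdges G O X).card = 2 ∧
      (joinEdges G O Y).card = 2 ∧ ∀ Z ∈ P.erase O, Z ≠ X → Z ≠ Y → joinEdges G O Z = ∅ := by
  have card_eq : ∀ Z ∈ P.erase O,
      (joinEdges G O Z).card = if (joinEdges G O Z).card = 2 then 2 else 0 := by
    intro Z hZ
    obtain ⟨hZO, hZP⟩ := Finset.mem_erase.1 hZ
    obtain h | h := hd O hO Z hZP hZO.symm <;> simp [h]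
  have sum_eq := hP.sum_card_joinEdges hO
  rw [Finset.sum_congr rfl card_eq, ← Finset.sum_filter, Finset.sum_const, smul_eq_mul] at sum_eq
  obtain ⟨X, Y, hXY, pair_eq⟩ := Finset.card_eq_two.1
    (Nat.eq_of_mul_eq_mul_right two_pos sum_eq : Finset.card _ = 2)
  have mem_iff (Z : Finset V) :
      Z ∈ P.erase O ∧ (joinEdges G O Z).card = 2 ↔ Z = X ∨ Z = Y := by
    simpa only [Finset.mem_filter, Finset.mem_insert, Finset.mem_singleton] using
      Finset.ext_iff.1 pair_eq Z
  obtain ⟨hX, hXcard⟩ := (mem_iff X).2 (.inl rfl)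
  obtain ⟨hY, hYcard⟩ := (mem_iff Y).2 (.inr rfl)
  refine ⟨X, hX, Y, hY, hXY, hXcard, hYcard, fun Z hZ hZX hZY => ?_⟩
  rw [← Finset.card_eq_zero, card_eq Z hZ, if_neg]
  exact fun h => ((mem_iff Z).1 ⟨hZ, h⟩).elim hZX hZY

theorem IsDoubled.exists_pairs (hd : IsDoubled G P) (hP : IsContraction G P) (hO : O ∈ P) :
    ∃ D₁ ⊆ cut G O, ∃ D₂ ⊆ cut G O, Disjoint D₁ D₂ ∧ D₁.card = 2 ∧ D₂.card = 2 ∧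
      ∀ T : Finset (Edge V), (T ∩ D₁).card = 1 → (T ∩ D₂).card = 1 →
        ∀ Z ∈ P.erase O, 2 * (T ∩ joinEdges G O Z).card = (joinEdges G O Z).card := by
  obtain ⟨X, hX, Y, hY, hXY, hXcard, hYcard, hempty⟩ := hd.exists_neighbors hP hO
  obtain ⟨hXO, hXP⟩ := Finset.mem_erase.1 hX
  obtain ⟨hYO, hYP⟩ := Finset.mem_erase.1 hY
  refine ⟨_, hP.joinEdges_subset_cut hO hXP hXO.symm, _, hP.joinEdges_subset_cut hO hYP hYO.symm,
    disjoint_joinEdges (hP.pairwiseDisjoint hO hXP hXO.symm) (hP.pairwiseDisjoint hXP hYP hXY),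
    hXcard, hYcard, fun T hTX hTY Z hZ => ?_⟩
  by_cases hZX : Z = X
  · rw [hZX, hTX, hXcard]
  by_cases hZY : Z = Y
  · rw [hZY, hTY, hYcard]
  rw [hempty Z hZ hZX hZY, Finset.inter_empty, Finset.card_empty]

theorem not_isDiag_of_mem_cut {e : Edge V} (he : e ∈ cut G X) : ¬ e.1.IsDiag := by
  rw [cut_eq_joinEdges, mem_joinEdges] at he
  obtain ⟨-, u, hu, v, hv, huv⟩ := he
  rw [huv, Sym2.mk_isDiag_iff]
  rintro rfl
  exact Finset.mem_compl.1 hv hu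

theorem mem_joinEdges_compl_verts {e : Edge V} (heS : e ∈ cut G (verts S)) (hX : X ∈ S)
    (heX : e ∈ cut G X) : e ∈ joinEdges G (verts S)ᶜ X := by
  rw [cut_eq_joinEdges, mem_joinEdges] at heS heX
  obtain ⟨heG, u, -, v, hv, huv⟩ := heS
  obtain ⟨-, u', hu', v', -, huv'⟩ := heX
  refine mem_joinEdges.2 ⟨heG, v, hv, u', hu', ?_⟩
  rw [huv] at huv' ⊢
  obtain ⟨rfl, -⟩ | ⟨-, rfl⟩ := Sym2.eq_iff.1 huv'
  · exact Sym2.eq_swap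
  · exact absurd (subset_verts hX hu') (Finset.mem_compl.1 hv)

theorem xor_mem_of_card_inter_eq_one {α : Type*} [DecidableEq α] {D T : Finset α} {a b : α}
    (hD : D.card = 2) (hT : (T ∩ D).card = 1) (ha : a ∈ D) (hb : b ∈ D) (hab : a ≠ b) :
    Xor (a ∈ T) (b ∈ T) := by
  obtain rfl : {a, b} = D := Finset.eq_of_subset_of_card_le
    (Finset.insert_subset ha (Finset.singleton_subset_iff.2 hb))
    (hD.trans_le (Finset.card_pair hab).ge)
  by_cases haT : a ∈ T <;> by_cases hbT : b ∈ T
  · rw [Finset.inter_eq_right.2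
      (Finset.insert_subset haT (Finset.singleton_subset_iff.2 hbT)), hD] at hT
    omega
  · exact .inl ⟨haT, hbT⟩
  · exact .inr ⟨hbT, haT⟩
  · rw [Finset.inter_insert_of_notMem haT, Finset.inter_singleton_of_notMem hbT] at hT
    simp at hT

end CycleCuts

section Executions

variable {V : Type*} [Fintype V] [DecidableEq V] {G : Finset (Edge V)} {f : Sym2 V}
  {P A : Finset (Finset V)} {i j : ℕ}

/-- Every vertex has degree four. -/
def IsFourRegular (G : Finset (Edge V)) : Prop :=
  ∀ v : V, (cut G {v}).card = 4

theorem IsFourRegular.three_le_card (hG : IsFourRegular G) (v : V) : 3 ≤ Fintype.card V := by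
  have cut_subset :
      cut G {v} ⊆ ((Finset.univ.erase v).image fun u => s(v, u)) ×ˢ Finset.univ := by
    intro e he
    rw [cut_eq_joinEdges] at he
    obtain ⟨-, u, hu, w, hw, huw⟩ := mem_joinEdges.1 he
    rw [Finset.mem_singleton] at hu
    subst hu
    rw [Finset.mem_compl, Finset.mem_singleton] at hw
    exact Finset.mem_product.2 ⟨Finset.mem_image.2
      ⟨w, Finset.mem_erase.2 ⟨hw, Finset.mem_univ w⟩, huw.symm⟩, Finset.mem_univ _⟩
  have four_le : 4 ≤ (Fintype.card V - 1) * 2 := by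
    calc 4 = (cut G {v}).card := (hG v).symm
      _ ≤ ((Finset.univ.erase v).image fun u => s(v, u)).card * 2 :=
          (Finset.card_le_card cut_subset).trans_eq (Finset.card_product _ _)
      _ ≤ (Fintype.card V - 1) * 2 := by
          refine Nat.mul_le_mul_right 2 (Finset.card_image_le.trans_eq ?_)
          rw [Finset.card_erase_of_mem (Finset.mem_univ v), Finset.card_univ]
  omega

theorem IsFourRegular.isContraction_singletons (hG : IsFourRegular G) :
    IsContraction G (Finset.univ.image fun v => {v}) where
  nonempty := Finset.forall_mem_image.2 fun v _ => Finset.singleton_nonempty v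
  pairwiseDisjoint := by
    rw [Finset.coe_image, Finset.coe_univ, Set.image_univ]
    exact Finset.pairwiseDisjoint_range_singleton
  verts_eq_univ := by
    ext v
    simp [mem_verts]
  card_cut := Finset.forall_mem_image.2 fun v _ => hG v

namespace IsContraction

theorem insert_verts_sdiff (hP : IsContraction G P) (hA : A ⊆ P) (hne : A.Nonempty)
    (hAt : IsTight G A) : IsContraction G (insert (verts A) (P \ A)) where
  nonempty := Finset.forall_mem_insert _ _ _ |>.2
    ⟨hP.verts_nonempty hA hne, fun X hX => hP.nonempty X (Finset.mem_sdiff.1 hX).1⟩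
  pairwiseDisjoint := by
    rw [Finset.coe_insert]
    refine (hP.pairwiseDisjoint_of_subset Finset.sdiff_subset).insert fun X hX _ => ?_
    obtain ⟨hXP, hXA⟩ := Finset.mem_sdiff.1 hX
    exact (hP.disjoint_verts hA hXP hXA).symm
  verts_eq_univ := by
    rw [verts_insert, hP.verts_sdiff hA, Finset.union_compl]
  card_cut := Finset.forall_mem_insert _ _ _ |>.2
    ⟨hAt, fun X hX => hP.card_cut X (Finset.mem_sdiff.1 hX).1⟩

theorem verts_notMem_sdiff (hP : IsContraction G P) (hA : A ⊆ P) (hne : A.Nonempty) :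
    verts A ∉ P \ A := by
  intro h
  obtain ⟨hAP, hAA⟩ := Finset.mem_sdiff.1 h
  exact (hP.verts_nonempty hA hne).ne_empty
    (Finset.disjoint_self_iff_empty _ |>.1 (hP.disjoint_verts hA hAP hAA))

theorem innerEdges_subset_union (hP : IsContraction G P) (hA : A ⊆ P) (hne : A.Nonempty) :
    innerEdges G P ⊆ innerEdges G A ∪ innerEdges G (insert (verts A) (P \ A)) := by
  intro e he
  obtain ⟨heG, X, hX, Y, hY, hXY, u, hu, v, hv, huv⟩ := mem_innerEdges.1 he
  have notMem := hP.verts_notMem_sdiff hA hne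
  rw [Finset.mem_union, mem_innerEdges, mem_innerEdges]
  by_cases hXA : X ∈ A <;> by_cases hYA : Y ∈ A
  · exact .inl ⟨heG, X, hXA, Y, hYA, hXY, u, hu, v, hv, huv⟩
  · have hY := Finset.mem_sdiff.2 ⟨hY, hYA⟩
    exact .inr ⟨heG, _, Finset.mem_insert_self _ _, Y, Finset.mem_insert_of_mem hY,
      fun h => notMem (h ▸ hY), u, subset_verts hXA hu, v, hv, huv⟩
  · have hX := Finset.mem_sdiff.2 ⟨hX, hXA⟩
    exact .inr ⟨heG, X, Finset.mem_insert_of_mem hX, _, Finset.mem_insert_self _ _,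
      fun h => notMem (h ▸ hX), u, hu, v, subset_verts hYA hv, huv⟩
  · exact .inr ⟨heG, X, Finset.mem_insert_of_mem (Finset.mem_sdiff.2 ⟨hX, hXA⟩), Y,
      Finset.mem_insert_of_mem (Finset.mem_sdiff.2 ⟨hY, hYA⟩), hXY, u, hu, v, hv, huv⟩

end IsContraction

namespace Execution

variable (R : Execution G f)

theorem sel_subset (hi : i ≤ R.k) : R.sel i ⊆ R.nodes i := by
  obtain hi | rfl := hi.lt_or_eq
  · exact (R.sel_candidate i hi).1.1.1
  · exact R.sel_last.subset

theorem sel_nonempty (hi : i < R.k) : (R.sel i).Nonempty :=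
  Finset.card_pos.1 (two_pos.trans_le (R.sel_candidate i hi).1.1.2.1)

theorem isContraction_nodes (hreg : IsFourRegular G) (hi : i ≤ R.k) :
    IsContraction G (R.nodes i) := by
  induction i with
  | zero => exact R.nodes_zero ▸ hreg.isContraction_singletons
  | succ i ih =>
    rw [R.nodes_succ i hi]
    exact (ih (Nat.le_of_succ_le hi)).insert_verts_sdiff (R.sel_subset (Nat.le_of_succ_le hi))
      (R.sel_nonempty hi) (R.sel_candidate i hi).1.2.1

theorem three_le_card_nodes (hreg : IsFourRegular G) (hi : i ≤ R.k) : 3 ≤ (R.nodes i).card := by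
  cases i with
  | zero =>
    rw [R.nodes_zero, Finset.card_image_of_injective _ Finset.singleton_injective]
    exact hreg.three_le_card f.out.1
  | succ i =>
    have hP := R.isContraction_nodes hreg (Nat.le_of_succ_le hi)
    have sdiff_card := (R.sel_candidate i hi).1.1.2.2
    rw [R.nodes_succ i hi, Finset.card_insert_of_notMem
      (hP.verts_notMem_sdiff (R.sel_subset (Nat.le_of_succ_le hi)) (R.sel_nonempty hi))]
    omega

theorem not_forall_mem_node (hf : ¬ f.IsDiag) (hi : i ≤ R.k) :
    ∀ X ∈ R.nodes i, ¬ ∀ v ∈ f, v ∈ X := by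
  induction i with
  | zero =>
    rw [R.nodes_zero]
    refine Finset.forall_mem_image.2 fun u _ h => hf ?_
    induction f with
    | _ a b =>
      obtain ⟨ha, hb⟩ := Sym2.forall_mem_pair.1 h
      rw [Finset.mem_singleton] at ha hb
      exact Sym2.mk_isDiag_iff.2 (ha.trans hb.symm)
  | succ i ih =>
    rw [R.nodes_succ i hi]
    exact Finset.forall_mem_insert _ _ _ |>.2 ⟨(R.sel_candidate i hi).2, fun X hX =>
      ih (Nat.le_of_succ_le hi) X (Finset.mem_sdiff.1 hX).1⟩

theorem exists_node_superset (hij : i ≤ j) (hj : j ≤ R.k) {X : Finset V} (hX : X ∈ R.nodes i) :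
    ∃ Y ∈ R.nodes j, X ⊆ Y := by
  induction j, hij using Nat.le_induction with
  | base => exact ⟨X, hX, subset_rfl⟩
  | succ j _ ih =>
    obtain ⟨Y, hY, hXY⟩ := ih (Nat.le_of_succ_le hj)
    rw [R.nodes_succ j hj]
    by_cases hYs : Y ∈ R.sel j
    · exact ⟨_, Finset.mem_insert_self _ _, hXY.trans (subset_verts hYs)⟩
    · exact ⟨Y, Finset.mem_insert_of_mem (Finset.mem_sdiff.2 ⟨hY, hYs⟩), hXY⟩

theorem disjoint_innerEdges_of_lt (hreg : IsFourRegular G) (hij : i < j) (hj : j ≤ R.k) :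
    Disjoint (innerEdges G (R.sel i)) (innerEdges G (R.sel j)) := by
  refine Finset.disjoint_left.2 fun e hei hej => ?_
  obtain ⟨-, X, hX, Y, hY, -, u, hu, v, hv, huv⟩ := mem_innerEdges.1 hei
  obtain ⟨-, X', hX', Y', hY', hne, hXY'⟩ := mem_innerEdges.1 hej
  have verts_mem : verts (R.sel i) ∈ R.nodes (i + 1) := by
    rw [R.nodes_succ i (hij.trans_le hj)]
    exact Finset.mem_insert_self _ _
  obtain ⟨Z, hZ, hsub⟩ := R.exists_node_superset hij hj verts_mem
  have huZ := hsub (subset_verts hX hu)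
  have hvZ := hsub (subset_verts hY hv)
  have hP := R.isContraction_nodes hreg hj
  obtain ⟨u', hu', v', hv', huv'⟩ := hXY'
  have ends (w : V) (hw : w ∈ s(u', v')) : w ∈ Z := by
    rw [← huv', huv] at hw
    obtain rfl | rfl := Sym2.mem_iff.1 hw <;> assumption
  exact hne ((hP.eq_of_mem (R.sel_subset hj hX') hZ hu' (ends u' (Sym2.mem_mk_left _ _))).trans
    (hP.eq_of_mem (R.sel_subset hj hY') hZ hv' (ends v' (Sym2.mem_mk_right _ _))).symm)

theorem pairwise_disjoint_innerEdges (hreg : IsFourRegular G) :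
    Pairwise fun i j : Fin (R.k + 1) =>
      Disjoint (innerEdges G (R.sel i)) (innerEdges G (R.sel j)) := by
  intro i j hij
  obtain h | h := lt_or_gt_of_ne hij
  · exact R.disjoint_innerEdges_of_lt hreg h (Nat.le_of_lt_succ j.2)
  · exact (R.disjoint_innerEdges_of_lt hreg h (Nat.le_of_lt_succ i.2)).symm

theorem exists_mem_innerEdges_or_mem_nodes (hreg : IsFourRegular G) {e : Edge V} (he : e ∈ G)
    (hloop : ¬ e.1.IsDiag) (hi : i ≤ R.k) :
    (∃ j < i, e ∈ innerEdges G (R.sel j)) ∨ e ∈ innerEdges G (R.nodes i) := by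
  induction i with
  | zero =>
    obtain ⟨X, hX, Y, hY, u, hu, v, hv, huv⟩ := (R.isContraction_nodes hreg hi).exists_joins e
    refine .inr (mem_innerEdges.2 ⟨he, X, hX, Y, hY, ?_, u, hu, v, hv, huv⟩)
    rintro rfl
    obtain ⟨w, -, rfl⟩ := Finset.mem_image.1 (R.nodes_zero ▸ hX)
    rw [Finset.mem_singleton] at hu hv
    exact hloop (huv ▸ Sym2.mk_isDiag_iff.2 (hu.trans hv.symm))
  | succ i ih =>
    obtain ⟨j, hj, hej⟩ | hei := ih (Nat.le_of_succ_le hi)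
    · exact .inl ⟨j, hj.trans i.lt_succ_self, hej⟩
    · have hP := R.isContraction_nodes hreg (Nat.le_of_succ_le hi)
      obtain h | h := Finset.mem_union.1 (hP.innerEdges_subset_union
        (R.sel_subset (Nat.le_of_succ_le hi)) (R.sel_nonempty hi) hei)
      · exact .inl ⟨i, i.lt_succ_self, h⟩
      · exact .inr (R.nodes_succ i hi ▸ h)

theorem exists_mem_innerEdges (hreg : IsFourRegular G) {e : Edge V} (he : e ∈ G)
    (hloop : ¬ e.1.IsDiag) : ∃ i : Fin (R.k + 1), e ∈ innerEdges G (R.sel i) := by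
  obtain ⟨j, hj, hej⟩ | hek := R.exists_mem_innerEdges_or_mem_nodes hreg he hloop le_rfl
  · exact ⟨⟨j, hj.trans R.k.lt_succ_self⟩, hej⟩
  · exact ⟨Fin.last R.k, by rwa [Fin.val_last, R.sel_last]⟩

end Execution

end Executions

section CycleCutProbability

variable {V : Type*} [Fintype V] [DecidableEq V] {G : Finset (Edge V)} {f : Sym2 V}
  {T : Finset (Edge V)} {Q Q' : Finset (Edge V) → Prop} {i : ℕ}

namespace Execution

variable (R : Execution G f)

/-- The node set of the graph which decides whether the set selected in round `i` is a cycle cut: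
the complement of this set is contracted to a node, and the root is kept as it is. -/
def localNodes (i : ℕ) : Finset (Finset V) :=
  if i < R.k then contractCompl (R.sel i) else R.nodes i

theorem sel_subset_localNodes (hi : i ≤ R.k) : R.sel i ⊆ R.localNodes i := by
  rw [localNodes]
  split_ifs
  · exact subset_contractCompl
  · exact R.sel_subset hi

theorem isContraction_localNodes (hreg : IsFourRegular G) (hi : i ≤ R.k) :
    IsContraction G (R.localNodes i) := by
  have hP := R.isContraction_nodes hreg hi
  rw [localNodes]
  split_ifs with hik
  · exact hP.isContraction_contractCompl (R.sel_candidate i hik).1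
  · exact hP

theorem isDoubled_localNodes (hG : IsFourEdgeConnected G) (hreg : IsFourRegular G)
    (hf : ∀ i, (f, i) ∈ G) (hdiag : ¬ f.IsDiag) (hi : i ≤ R.k) (hc : R.IsCycle i) :
    IsDoubled G (R.localNodes i) := by
  have hP := R.isContraction_nodes hreg hi
  rw [localNodes]
  split_ifs with hik
  · exact hP.isDoubled_contractCompl hG (R.sel_candidate i hik) (R.sel_minimal i hik)
      (hc.resolve_left hik.ne)
  · obtain rfl := hi.antisymm (not_lt.1 hik)
    exact hP.isDoubled_of_doubled_pair hG R.loop_end (R.three_le_card_nodes hreg hi) hf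
      (R.not_forall_mem_node hdiag hi)

theorem exists_isDeterminantal_law (hG : IsFourEdgeConnected G) (hreg : IsFourRegular G)
    (hf : ∀ i, (f, i) ∈ G) (hdiag : ¬ f.IsDiag) (hi : i ≤ R.k) :
    ∃ K, IsDeterminantal (R.law i) (innerEdges G (R.sel i)) K ∧
      ∀ e ∈ innerEdges G (R.sel i), K e e = 1 / 2 := by
  have hP := R.isContraction_nodes hreg hi
  obtain hik | rfl := hi.lt_or_eq
  · exact (R.law_maxEntropy i hik).exists_isDeterminantal
      (hP.pairwiseDisjoint_of_subset (R.sel_subset hi)) (R.sel_nonempty hik)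
  · rw [R.law_last, R.sel_last]
    have hcard := R.three_le_card_nodes hreg hi
    have hfP := R.not_forall_mem_node hdiag hi
    exact hP.exists_isDeterminantal_tourLaw hG
      (hP.isDoubled_of_doubled_pair hG R.loop_end hcard hf hfP) hcard hf hfP

/-- The law of the random edge set `T`. -/
noncomputable def edgeLaw : Finset (Edge V) → ℝ :=
  unionLaw fun i : Fin (R.k + 1) => R.law i

theorem exists_isDeterminantal_edgeLaw (hG : IsFourEdgeConnected G) (hreg : IsFourRegular G)
    (hf : ∀ i, (f, i) ∈ G) (hdiag : ¬ f.IsDiag) :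
    ∃ E K, IsDeterminantal R.edgeLaw E K ∧ ∀ e ∈ G, ¬ e.1.IsDiag → K e e = 1 / 2 := by
  obtain ⟨K, hK, half⟩ := exists_isDeterminantal_unionLaw
    (fun i : Fin (R.k + 1) => R.exists_isDeterminantal_law hG hreg hf hdiag (Nat.le_of_lt_succ i.2))
    (R.pairwise_disjoint_innerEdges hreg)
  refine ⟨_, K, hK, fun e he hloop => ?_⟩
  obtain ⟨i, hi⟩ := R.exists_mem_innerEdges hreg he hloop
  exact half i e hi

theorem law_inter_ne_zero (hG : IsFourEdgeConnected G) (hreg : IsFourRegular G)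
    (hf : ∀ i, (f, i) ∈ G) (hdiag : ¬ f.IsDiag) (hT : R.edgeLaw T ≠ 0) (hi : i ≤ R.k) :
    R.law i (T ∩ innerEdges G (R.sel i)) ≠ 0 := by
  refine apply_inter_ne_zero_of_unionLaw_ne_zero (fun j => ?_)
    (R.pairwise_disjoint_innerEdges hreg) hT ⟨i, Nat.lt_succ_of_le hi⟩
  obtain ⟨K, hK, -⟩ := R.exists_isDeterminantal_law hG hreg hf hdiag (Nat.le_of_lt_succ j.2)
  exact hK.support

open Classical in
theorem prob_eq_sum (Q : Finset (Edge V) → Prop) : R.prob Q = ∑ T with Q T, R.edgeLaw T := by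
  have indicator_eq := sum_unionLaw_mul (fun i : Fin (R.k + 1) => R.law i)
    fun T => if Q T then 1 else 0
  simp only [mul_ite, mul_one, mul_zero] at indicator_eq
  rw [Finset.sum_filter, edgeLaw, indicator_eq, prob]

theorem prob_mono (hG : IsFourEdgeConnected G) (hreg : IsFourRegular G) (hf : ∀ i, (f, i) ∈ G)
    (hdiag : ¬ f.IsDiag) (h : ∀ T, R.edgeLaw T ≠ 0 → Q T → Q' T) : R.prob Q ≤ R.prob Q' := by
  classical
  obtain ⟨E, K, hK, -⟩ := R.exists_isDeterminantal_edgeLaw hG hreg hf hdiag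
  rw [R.prob_eq_sum, R.prob_eq_sum, ← Finset.sum_filter_ne_zero]
  refine Finset.sum_le_sum_of_subset_of_nonneg (fun T hT => ?_) fun T _ _ => hK.nonneg T
  obtain ⟨hT, hne⟩ := Finset.mem_filter.1 hT
  exact Finset.mem_filter.2 ⟨Finset.mem_univ T, h T hne (Finset.mem_filter.1 hT).2⟩

theorem prob_true (hG : IsFourEdgeConnected G) (hreg : IsFourRegular G) (hf : ∀ i, (f, i) ∈ G)
    (hdiag : ¬ f.IsDiag) : R.prob (fun _ => True) = 1 := by
  obtain ⟨E, K, hK, -⟩ := R.exists_isDeterminantal_edgeLaw hG hreg hf hdiag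
  rw [R.prob_eq_sum, Finset.filter_true, hK.sum_eq_one]

theorem halvesJoins_sel (hG : IsFourEdgeConnected G) (hreg : IsFourRegular G)
    (hf : ∀ i, (f, i) ∈ G) (hdiag : ¬ f.IsDiag) (hi : i ≤ R.k) (hc : R.IsCycle i)
    (hT : R.edgeLaw T ≠ 0) : HalvesJoins G (R.sel i) T := by
  rw [← halvesJoins_inter_innerEdges]
  have hP := R.isContraction_nodes hreg hi
  have hd := (R.isDoubled_localNodes hG hreg hf hdiag hi hc).mono (R.sel_subset_localNodes hi)
  have law_ne_zero := R.law_inter_ne_zero hG hreg hf hdiag hT hi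
  obtain hik | rfl := hi.lt_or_eq
  · exact (R.law_maxEntropy i hik).halvesJoins (hP.pairwiseDisjoint_of_subset (R.sel_subset hi))
      (R.sel_nonempty hik) hd law_ne_zero
  · rw [R.sel_last] at hd law_ne_zero ⊢
    rw [R.law_last] at law_ne_zero
    refine hP.halvesJoins_of_isTour (f := f) hd (R.three_le_card_nodes hreg hi) ?_
    by_contra hT
    exact law_ne_zero (if_neg hT)

/-- Inside a cycle cut the samples halve the parallel pairs with certainty. Only the two pairs at
the contracted complement are left to chance, and a determinantal law of marginals `1 / 2` halves
two given pairs with probability at least `1 / 4`. -/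
theorem quarter_le_prob_halvesJoins (hG : IsFourEdgeConnected G) (hreg : IsFourRegular G)
    (hf : ∀ i, (f, i) ∈ G) (hdiag : ¬ f.IsDiag) (hi : i ≤ R.k) (hc : R.IsCycle i) :
    1 / 4 ≤ R.prob (HalvesJoins G (R.localNodes i)) := by
  classical
  have hP := R.isContraction_localNodes hreg hi
  have hd := R.isDoubled_localNodes hG hreg hf hdiag hi hc
  obtain hik | rfl := hi.lt_or_eq
  · rw [localNodes, if_pos hik] at hP hd ⊢
    have compl_notMem := (R.isContraction_nodes hreg hi).compl_verts_notMem (R.sel_subset hi)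
    obtain ⟨D₁, hD₁, D₂, hD₂, hD, hcard₁, hcard₂, halves⟩ :=
      hd.exists_pairs hP compl_verts_mem_contractCompl
    obtain ⟨E, K, hK, half⟩ := R.exists_isDeterminantal_edgeLaw hG hreg hf hdiag
    have quarter_le := hK.quarter_le_sum_split hD hcard₁ hcard₂ fun e he =>
      have he := Finset.union_subset hD₁ hD₂ he
      half e (Finset.mem_filter.1 he).1 (not_isDiag_of_mem_cut he)
    calc 1 / 4 ≤ R.prob fun T => (T ∩ D₁).card = 1 ∧ (T ∩ D₂).card = 1 := by
          rw [R.prob_eq_sum]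
          convert quarter_le
      _ ≤ R.prob (HalvesJoins G (contractCompl (R.sel i))) :=
          R.prob_mono hG hreg hf hdiag fun T hT ⟨hT₁, hT₂⟩ =>
            (R.halvesJoins_sel hG hreg hf hdiag hi hc hT).insert fun Z hZ =>
              halves T hT₁ hT₂ Z (Finset.mem_erase.2
                ⟨ne_of_mem_of_not_mem hZ compl_notMem, subset_contractCompl hZ⟩)
  · rw [localNodes, if_neg (lt_irrefl _), ← R.sel_last]
    calc (1 / 4 : ℝ) ≤ 1 := by norm_num
      _ = R.prob fun _ => True := (R.prob_true hG hreg hf hdiag).symm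
      _ ≤ R.prob (HalvesJoins G (R.sel R.k)) :=
          R.prob_mono hG hreg hf hdiag fun T hT _ => R.halvesJoins_sel hG hreg hf hdiag hi hc hT

theorem even_card_inter_cut (hreg : IsFourRegular G) (hi : i ≤ R.k)
    (hT : HalvesJoins G (R.localNodes i) T) {B : Finset (Finset V)} (hB : B ⊆ R.sel i)
    (hBt : IsTight G B) : Even (T ∩ cut G (verts B)).card := by
  rw [hT.card_inter_cut (R.isContraction_localNodes hreg hi)
    (hB.trans (R.sel_subset_localNodes hi)) hBt]
  exact even_two

theorem xor_mem_of_isCyclePartners (hG : IsFourEdgeConnected G) (hreg : IsFourRegular G)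
    (hf : ∀ i, (f, i) ∈ G) (hdiag : ¬ f.IsDiag) (hi : i ≤ R.k) (hc : R.IsCycle i)
    (hT : HalvesJoins G (R.localNodes i) T) {a b : Edge V} (h : R.IsCyclePartners i a b) :
    Xor (a ∈ T) (b ∈ T) := by
  obtain ⟨hab, haS, hbS, X, hX, haX, hbX⟩ := h
  have ha := mem_joinEdges_compl_verts haS hX haX
  have hb := mem_joinEdges_compl_verts hbS hX hbX
  obtain hik | rfl := hi.lt_or_eq
  · have hd := R.isDoubled_localNodes hG hreg hf hdiag hi hc
    rw [localNodes, if_pos hik] at hT hd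
    have hO : (verts (R.sel i))ᶜ ≠ X := ne_of_mem_of_not_mem hX
      ((R.isContraction_nodes hreg hi).compl_verts_notMem (R.sel_subset hi)) |>.symm
    have card_eq := (hd _ compl_verts_mem_contractCompl X (subset_contractCompl hX) hO).resolve_left
      (Finset.card_ne_zero_of_mem ha)
    have card_inter := hT _ compl_verts_mem_contractCompl X (subset_contractCompl hX) hO
    exact xor_mem_of_card_inter_eq_one card_eq (by omega) ha hb hab
  · rw [R.sel_last, (R.isContraction_nodes hreg hi).verts_eq_univ] at haS
    obtain ⟨-, u, -, v, hv, -⟩ := mem_joinEdges.1 (cut_eq_joinEdges (G := G) ▸ haS)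
    simp at hv

theorem quarter_le_prob_evenAtLast_and_partnersSplit (hG : IsFourEdgeConnected G)
    (hreg : IsFourRegular G) (hf : ∀ i, (f, i) ∈ G) (hdiag : ¬ f.IsDiag) {e : Edge V}
    (hb : R.IsBottom e) : 1 / 4 ≤ R.prob fun T => R.EvenAtLast e T ∧ R.PartnersSplit e T := by
  obtain ⟨i, hi, hc⟩ := hb
  refine (R.quarter_le_prob_halvesJoins hG hreg hf hdiag hi.1 hc).trans
    (R.prob_mono hG hreg hf hdiag fun T _ hT => ⟨⟨i, hi, ?_, fun h => absurd hc h⟩, i, hi, ?_⟩)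
  · exact fun _ B hB hBt _ => R.even_card_inter_cut hreg hi.1 hT hB hBt
  · exact fun a b hab => R.xor_mem_of_isCyclePartners hG hreg hf hdiag hi.1 hc hT hab

end Execution

end CycleCutProbability

section SupportGraph

variable {V : Type*} [Fintype V] {x : Sym2 V → ℝ} {f : Sym2 V}

theorem mem_supportGraph_of_eq_one (hf : x f = 1) (i : Fin 2) : (f, i) ∈ supportGraph x := by
  simp only [supportGraph, Finset.mem_filter, Finset.mem_univ, true_and, hf]
  fin_cases i <;> norm_num

variable [DecidableEq V]

namespace IsHalfIntegralSubtour

theorem not_isDiag_of_eq_one (hx : IsHalfIntegralSubtour x) (hf : x f = 1) : ¬ f.IsDiag := by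
  induction f with
  | _ u v =>
    intro hdiag
    obtain rfl := Sym2.mk_isDiag_iff.1 hdiag
    exact zero_ne_one ((hx.loopless u).symm.trans hf)

theorem card_cut_supportGraph (hx : IsHalfIntegralSubtour x) (X : Finset V) :
    ((cut (supportGraph x) X).card : ℝ) = 2 * ∑ u ∈ X, ∑ v ∈ Xᶜ, x s(u, v) := by
  have card_copies (f : Sym2 V) :
      ((Finset.univ.filter fun i => (f, i) ∈ supportGraph x).card : ℝ) = 2 * x f := by
    simp only [supportGraph, Finset.mem_filter, Finset.mem_univ, true_and, Finset.card_filter,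
      Fin.sum_univ_two]
    obtain h | h | h := hx.half_integral f <;> rw [h] <;> norm_num
  rw [cut_eq_joinEdges, card_joinEdges_eq_sum disjoint_compl_right]
  simp only [card_joinEdges_singleton, Nat.cast_sum, card_copies, Finset.mul_sum]

theorem isFourEdgeConnected (hx : IsHalfIntegralSubtour x) :
    IsFourEdgeConnected (supportGraph x) := by
  intro X hX hX'
  have : (4 : ℝ) ≤ (cut (supportGraph x) X).card := by
    rw [hx.card_cut_supportGraph]
    linarith [hx.subtour X hX hX']
  exact_mod_cast this

theorem isFourRegular (hx : IsHalfIntegralSubtour x) : IsFourRegular (supportGraph x) := by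
  intro v
  have degree := Fintype.sum_eq_add_sum_compl v fun u => x s(v, u)
  rw [hx.degree, hx.loopless, zero_add] at degree
  have : ((cut (supportGraph x) {v}).card : ℝ) = 4 := by
    rw [hx.card_cut_supportGraph, Finset.sum_singleton, ← degree]
    norm_num
  exact_mod_cast this

end IsHalfIntegralSubtour

end SupportGraph

end HalfIntegralTSP

theorem mainTheorem6_general {V : Type*} [Fintype V] [DecidableEq V] {G : Finset (Edge V)}
    (hG : HalfIntegralTSP.IsFourEdgeConnected G) (hreg : HalfIntegralTSP.IsFourRegular G)
    {f : Sym2 V} (hf : ∀ i, (f, i) ∈ G) (hdiag : ¬ f.IsDiag)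
    (R : HalfIntegralTSP.Execution G f) {e : Edge V} (hb : R.IsBottom e) :
    R.IsGood e (1 / 4) ∧ 1 / 4 ≤ R.prob (R.PartnersSplit e) := by
  have hboth := R.quarter_le_prob_evenAtLast_and_partnersSplit hG hreg hf hdiag hb
  exact ⟨⟨by norm_num, hboth.trans (R.prob_mono hG hreg hf hdiag fun _ _ h => h.1)⟩,
    hboth.trans (R.prob_mono hG hreg hf hdiag fun _ _ h => h.2)⟩

theorem mainTheorem6 {V : Type*} [Fintype V] [DecidableEq V] (x : Sym2 V → ℝ)
    (hx : HalfIntegralTSP.IsHalfIntegralSubtour x) (f : Sym2 V) (hf : x f = 1)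
    (R : HalfIntegralTSP.Execution (HalfIntegralTSP.supportGraph x) f)
    (e : Edge V) (he : e ∈ HalfIntegralTSP.supportGraph x) (hb : R.IsBottom e) :
    R.IsGood e (3 / 16) ∧ 3 / 16 ≤ R.prob (R.PartnersSplit e) := by
  obtain ⟨⟨-, heven⟩, hsplit⟩ := mainTheorem6_general hx.isFourEdgeConnected hx.isFourRegular
    (HalfIntegralTSP.mem_supportGraph_of_eq_one hf) (hx.not_isDiag_of_eq_one hf) R hb
  exact ⟨⟨by norm_num, by linarith⟩, by linarith⟩
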